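/- Let $(S,\Sigma,P)$ be a probability space that is adequate: either $P$ is nonatomic (every event $A$ with $P(A)>0$ contains an event $B$ with $0<P(B)<P(A)$), or $\Sigma$ is generated by a finite partition of $S$ into events of equal probability. Let $\mathcal F$ (the space of random payoffs) be either $\mathcal L^\infty$, the space of almost surely bounded random variables $S\to\mathbb R$, or $\mathcal M^\infty$, the space of random variables $S\to\mathbb R$ with finite absolute moments of all orders. Write $f\overset{d}{=}g$ for equality in distribution. A risk preference is a transitive relation $\succsim$ on $\mathcal F$ that is law invariant: $f\overset{d}{=}g$ implies $f\succsim g$ and $g\succsim f$. It is continuous when $f_n\succsim g_n$ for all $n$, $f_n\to f$ and $g_n\to g$ imply $f\succsim g$, for all sequences $(f_n)$, $(g_n)$ and all $f,g$ in $\mathcal F$; here $f_n\to f$ means $\mathbb E[|f_n-f|^p]\to0$ for all integers $p\ge1$. If $\mathcal F=\mathcal L^\infty$, it is enough to require this when $f_n\to f$ is read as almost sure convergence of a sequence that is bounded in $\|\cdot\|_\infty$ (and likewise for $g_n \to g$). For $w,f\in\mathcal F$, say that $f$ is - a proportional insurance for $w$ if $f=-(1-\varepsilon)w-\pi$ for some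 $\pi\in\mathbb R$ and $\varepsilon\in[0,1)$; - a deductible-limit insurance for $w$ if $f=\min\{(-w-\delta)^+,\lambda\}-\pi$ for some $\pi,\delta\in\mathbb R$ and $\lambda\in[0,\infty)$; - an indemnity-schedule insurance for $w$ if $f=I(-w)$ for some nondecreasing real-valued map $I$ defined on the image of $-w$; - a contingency-schedule insurance for $w$ if, for $P\times P$-almost all $(s,s')$, $-w(s)>-w(s')$ implies $f(s)\ge f(s')$. For $w,f,g\in\mathcal F$, $f$ is a better hedge for $w$ than $g$ if $f\overset{d}{=}g$ and $P(f\le\tau\mid w\le\lambda)\le P(g\le\tau\mid w\le\lambda)$ for all $\tau,\lambda\in\mathbb R$ with $P(w\le\lambda)>0$. A risk preference $\succsim$ is propense to one of these four types of insurance if $w+f\succsim w+g$ for all $w,f,g\in\mathcal F$ such that $g\overset{d}{=}f$ and $f$ is an insurance of that type for $w$; it is propense to hedging if $w+f\succsim w+g$ for all $w,f,g\in\mathcal F$ such that $f$ is a better hedge for $w$ than $g$. It is strongly risk averse if $f\succsim g$ whenever $f,g\in\mathcal F$ satisfy $\mathbb E[\varphi(f)]\ge\mathbb E[\varphi(g)]$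 for all concave $\varphi:\mathbb R\to\mathbb R$, where these expectations take values in $[-\infty,\infty)$. **Theorem.** The following properties are equivalent for a continuous risk preference $\succsim$ on $\mathcal F$: (i) strong risk aversion; (ii) propensity to proportional insurance; (iii) propensity to deductible-limit insurance; (iv) propensity to indemnity-schedule insurance; (v) propensity to contingency-schedule insurance; (vi) propensity to hedging. -/

import Mathlib

open MeasureTheory Filter Topology
open scoped ENNReal

namespace RiskInsurance

section Spaces

variable {S : Type*} [MeasurableSpace S]

/-- Every event of positive probability splits into events of strictly smaller positive
probability. -/
def Nonatomic (P : Measure S) : Prop :=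
  ∀ A : Set S, MeasurableSet A → 0 < P A →
    ∃ B : Set S, MeasurableSet B ∧ B ⊆ A ∧ 0 < P B ∧ P B < P A

/-- `P` is uniform on a finite partition (the cells `C i`) that generates the σ-algebra. -/
def UniformOnGeneratingPartition (P : Measure S) : Prop :=
  ∃ (n : ℕ) (C : Fin n → Set S),
    Pairwise (fun i j => Disjoint (C i) (C j)) ∧ (⋃ i, C i) = Set.univ ∧
    ‹MeasurableSpace S› = MeasurableSpace.generateFrom (Set.range C) ∧
    ∀ i, P (C i) = (n : ℝ≥0∞)⁻¹

def Adequate (P : Measure S) : Prop :=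
  Nonatomic P ∨ UniformOnGeneratingPartition P

/-- The space of almost surely bounded random variables. -/
def LInfty (P : Measure S) : Submodule ℝ (S → ℝ) where
  carrier := {f | Measurable f ∧ MemLp f ∞ P}
  add_mem' hf hg := ⟨hf.1.add hg.1, hf.2.add hg.2⟩
  zero_mem' := ⟨measurable_const, MemLp.zero⟩
  smul_mem' c _ hf := ⟨hf.1.const_smul c, hf.2.const_smul c⟩

/-- The space of random variables with finite moments of all orders. -/
def MInfty (P : Measure S) : Submodule ℝ (S → ℝ) where
  carrier := {f | Measurable f ∧ ∀ p : ℕ, MemLp f (p : ℝ≥0∞) P}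
  add_mem' hf hg := ⟨hf.1.add hg.1, fun p => (hf.2 p).add (hg.2 p)⟩
  zero_mem' := ⟨measurable_const, fun _ => MemLp.zero⟩
  smul_mem' c _ hf := ⟨hf.1.const_smul c, fun p => (hf.2 p).const_smul c⟩

/-- Equality in distribution. -/
def EqDistr (P : Measure S) (f g : S → ℝ) : Prop :=
  P.map f = P.map g

/-- The expectation `E[X⁺] - E[X⁻]` in the extended reals. It is the usual expectation whenever one
of the two parts is finite, as it is for a concave function of an integrable random variable (whose
expectation may be `-∞`). -/
noncomputable def extExpectation (P : Measure S) (X : S → ℝ) : EReal :=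
  ((∫⁻ s, ENNReal.ofReal (X s) ∂P : ℝ≥0∞) : EReal) -
    ((∫⁻ s, ENNReal.ofReal (-X s) ∂P : ℝ≥0∞) : EReal)

/-- The concave order `f ≥_cv g`. -/
def ConcaveGE (P : Measure S) (f g : S → ℝ) : Prop :=
  ∀ φ : ℝ → ℝ, ConcaveOn ℝ Set.univ φ →
    extExpectation P (fun s => φ (g s)) ≤ extExpectation P (fun s => φ (f s))

/-! ### Insurance contracts and hedges -/

/-- `f` is a proportional insurance for `w`. -/
def IsProportionalInsurance (w f : S → ℝ) : Prop :=
  ∃ π ε : ℝ, 0 ≤ ε ∧ ε < 1 ∧ ∀ s, f s = -(1 - ε) * w s - π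

/-- `f` is a deductible-limit insurance for `w`, with deductible `δ` and limit `l`. -/
def IsDeductibleLimitInsurance (w f : S → ℝ) : Prop :=
  ∃ π δ l : ℝ, 0 ≤ l ∧ ∀ s, f s = min (max (-w s - δ) 0) l - π

/-- `f` is an indemnity-schedule insurance for `w`. -/
def IsIndemnityScheduleInsurance (w f : S → ℝ) : Prop :=
  ∃ I : ℝ → ℝ, MonotoneOn I (Set.range fun s => -w s) ∧ ∀ s, f s = I (-w s)

/-- `f` is a contingency-schedule insurance for `w`. -/
def IsContingencyScheduleInsurance (P : Measure S) (w f : S → ℝ) : Prop :=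
  ∀ᵐ z ∂(P.prod P), -w z.1 > -w z.2 → f z.1 ≥ f z.2

/-- `f` is a better hedge for `w` than `g`. Where `P (w ≤ l) = 0` the conditional probabilities are
both `0`, so that such levels `l` impose no condition. -/
def IsBetterHedge (P : Measure S) (w f g : S → ℝ) : Prop :=
  EqDistr P f g ∧ ∀ τ l : ℝ,
    ProbabilityTheory.cond P {s | w s ≤ l} {s | f s ≤ τ} ≤
      ProbabilityTheory.cond P {s | w s ≤ l} {s | g s ≤ τ}

end Spaces

section Preferences

variable {S : Type*} [MeasurableSpace S] {F : Submodule ℝ (S → ℝ)}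

/-- A risk preference: a transitive and law invariant relation; `R f g` reads "`f` is preferred to
`g`" (weakly). -/
structure IsRiskPreference (P : Measure S) (R : F → F → Prop) : Prop where
  trans : ∀ f g h : F, R f g → R g h → R f h
  law_invariant : ∀ f g : F, EqDistr P (f : S → ℝ) (g : S → ℝ) → R f g ∧ R g f

/-- Convergence in all integer `p`-norms. -/
def MomentConverges (P : Measure S) (u : ℕ → F) (f : F) : Prop :=
  ∀ p : ℕ, 1 ≤ p →
    Tendsto (fun n => ∫ s, |(u n : S → ℝ) s - (f : S → ℝ) s| ^ p ∂P) atTop (𝓝 0)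

/-- Almost sure convergence of a sequence that is bounded in the essential supremum norm. -/
def BoundedAEConverges (P : Measure S) (u : ℕ → F) (f : F) : Prop :=
  (∃ C : ℝ, ∀ n, ∀ᵐ s ∂P, |(u n : S → ℝ) s| ≤ C) ∧
    ∀ᵐ s ∂P, Tendsto (fun n => (u n : S → ℝ) s) atTop (𝓝 ((f : S → ℝ) s))

/-- Continuity of a preference with respect to a notion of convergence of sequences. -/
def ContinuousFor (Conv : (ℕ → F) → F → Prop) (R : F → F → Prop) : Prop :=
  ∀ (u v : ℕ → F) (f g : F), Conv u f → Conv v g → (∀ n, R (u n) (v n)) → R f g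

def StronglyRiskAverse (P : Measure S) (R : F → F → Prop) : Prop :=
  ∀ f g : F, ConcaveGE P (f : S → ℝ) (g : S → ℝ) → R f g

def PropenseToProportionalInsurance (P : Measure S) (R : F → F → Prop) : Prop :=
  ∀ w f g : F, EqDistr P (g : S → ℝ) (f : S → ℝ) →
    IsProportionalInsurance (w : S → ℝ) (f : S → ℝ) → R (w + f) (w + g)

def PropenseToDeductibleLimitInsurance (P : Measure S) (R : F → F → Prop) : Prop :=
  ∀ w f g : F, EqDistr P (g : S → ℝ) (f : S → ℝ) →
    IsDeductibleLimitInsurance (w : S → ℝ) (f : S → ℝ) → R (w + f) (w + g)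

def PropenseToIndemnityScheduleInsurance (P : Measure S) (R : F → F → Prop) : Prop :=
  ∀ w f g : F, EqDistr P (g : S → ℝ) (f : S → ℝ) →
    IsIndemnityScheduleInsurance (w : S → ℝ) (f : S → ℝ) → R (w + f) (w + g)

def PropenseToContingencyScheduleInsurance (P : Measure S) (R : F → F → Prop) : Prop :=
  ∀ w f g : F, EqDistr P (g : S → ℝ) (f : S → ℝ) →
    IsContingencyScheduleInsurance P (w : S → ℝ) (f : S → ℝ) → R (w + f) (w + g)

def PropenseToHedging (P : Measure S) (R : F → F → Prop) : Prop :=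
  ∀ w f g : F, EqDistr P (g : S → ℝ) (f : S → ℝ) →
    IsBetterHedge P (w : S → ℝ) (f : S → ℝ) (g : S → ℝ) → R (w + f) (w + g)

end Preferences

end RiskInsurance

open RiskInsurance

/-! On equally likely states the elementary reduction of risk is a Robin Hood transfer: an amount
passes from a better state to a worse one without reversing their order. Each insurance property
contains these transfers. If `g` is the contract `f` with its values at two labels exchanged, then
`f` and `g` have the same law, and `w + f` and `w + g` differ only at these two labels; a suitable
contract makes the difference any prescribed transfer. Strong risk aversion contains the transfers
by concavity.

Conversely, transfers generate the whole stop-loss order (`PropenseToTransfers.rel_of_stopLossGE`).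
Law invariance allows both payoffs to be rearranged increasingly along the same labels. Their cell
averages then have ordered partial sums, and by the argument of Hardy, Littlewood and Pólya finitely
many transfers connect them (`rel_of_partialSums_le`). On a nonatomic space the averages are
conditional expectations along a refining sequence of cells, so martingale convergence and
continuity carry the comparison to the limit; on a finite space the averages are the payoffs
themselves.

The cycle closes because a better hedge improves the total payoff in the stop-loss order
(`IsBetterHedge.stopLossGE_add`), while the contract classes are nested: proportional and
deductible-limit contracts are indemnity schedules, these are contingency schedules, and these are
better hedges than any payoff with the same law. -/

namespace RiskInsurance

/-! ### Majorization by Robin Hood transfers -/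

/-- A relation that is compatible with all Robin Hood transfers ranks `x` over `y` whenever `x` is
sorted and its partial sums dominate those of `y`, with equal totals. -/
theorem rel_of_partialSums_le {N : ℕ} (Q : (Fin N → ℝ) → (Fin N → ℝ) → Prop)
    (hrefl : ∀ x, Q x x) (htrans : ∀ x y z, Q x y → Q y z → Q x z)
    (htransfer : ∀ (y : Fin N → ℝ) (j k : Fin N) (d : ℝ), j ≠ k → 0 ≤ d → y j + d ≤ y k - d →
      Q (y + Pi.single j d - Pi.single k d) y)
    {x : Fin N → ℝ} (hx : Monotone x) (y : Fin N → ℝ)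
    (hle : ∀ m : Fin N, ∑ i ∈ Finset.Iic m, y i ≤ ∑ i ∈ Finset.Iic m, x i)
    (htot : ∑ i, y i = ∑ i, x i) : Q x y := by
  classical
  induction hn : (Finset.univ.filter fun i => x i ≠ y i).card using Nat.strong_induction_on
    generalizing y with
  | _ n ih =>
  by_cases hxy : x = y
  · subst hxy; exact hrefl x
  -- an index at which `y` is too large, the first such
  have hex : ∃ k, x k < y k := by
    by_contra! h
    have := (Finset.sum_eq_sum_iff_of_le (fun i (_ : i ∈ Finset.univ) => h i)).1 htot
    exact hxy (funext fun i => (this i (Finset.mem_univ i)).symm)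
  obtain ⟨k, hk, hkmin⟩ : ∃ k, x k < y k ∧ ∀ i < k, y i ≤ x i := by
    let s := Finset.univ.filter fun i => x i < y i
    have hs : s.Nonempty := by obtain ⟨k, hk⟩ := hex; exact ⟨k, by simp [s, hk]⟩
    refine ⟨s.min' hs, (Finset.mem_filter.1 (s.min'_mem hs)).2, fun i hi => ?_⟩
    by_contra! h
    exact absurd (s.min'_le i (by simp [s, h])) (not_le.2 hi)
  -- an earlier index at which `y` is too small
  obtain ⟨j, hjk, hj⟩ : ∃ j < k, y j < x j := by
    by_contra! h
    have hlt : ∑ i ∈ Finset.Iic k, x i < ∑ i ∈ Finset.Iic k, y i := by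
      refine Finset.sum_lt_sum (fun i hi => ?_) ⟨k, by simp, hk⟩
      rcases (Finset.mem_Iic.1 hi).lt_or_eq with h1 | rfl
      · exact h i h1
      · exact hk.le
    exact absurd (hle k) (not_le.2 hlt)
  have hxjk : x j ≤ x k := hx hjk.le
  -- This amount makes `y'` agree with `x` at `j` or at `k`, so the number of disagreements falls.
  -- The order is not reversed, since `y j + d ≤ x j ≤ x k ≤ y k - d`.
  set d := min (x j - y j) (y k - x k) with hd
  have hd0 : 0 < d := lt_min (by linarith) (by linarith)
  have hd1 : d ≤ x j - y j := min_le_left _ _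
  have hd2 : d ≤ y k - x k := min_le_right _ _
  set y' : Fin N → ℝ := y + Pi.single j d - Pi.single k d with hy'
  have hy'j : y' j = y j + d := by simp [hy', hjk.ne]
  have hy'k : y' k = y k - d := by simp [hy', hjk.ne']
  have hy'i : ∀ i, i ≠ j → i ≠ k → y' i = y i := fun i h1 h2 => by simp [hy', h1, h2]
  refine htrans x y' y ?_ (htransfer y j k d hjk.ne hd0.le (by linarith))
  have hsum : ∀ t : Finset (Fin N), ∑ i ∈ t, y' i =
      ∑ i ∈ t, y i + (if j ∈ t then d else 0) - (if k ∈ t then d else 0) := by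
    intro t
    simp only [hy', Pi.add_apply, Pi.sub_apply, Finset.sum_add_distrib, Finset.sum_sub_distrib,
      Finset.sum_pi_single']
  refine ih _ ?_ y' (fun m => ?_) ?_ rfl
  · rw [← hn]
    apply Finset.card_lt_card
    rw [Finset.ssubset_iff_of_subset]
    · rcases min_choice (x j - y j) (y k - x k) with h | h
      · exact ⟨j, by simp [hj.ne'], by simp only [Finset.mem_filter, hy'j, hd, h]; simp⟩
      · exact ⟨k, by simp [hk.ne], by simp only [Finset.mem_filter, hy'k, hd, h]; simp⟩
    · intro i
      simp only [Finset.mem_filter, Finset.mem_univ, true_and]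
      intro hi
      by_cases h1 : i = j
      · subst h1; exact hj.ne'
      by_cases h2 : i = k
      · subst h2; exact hk.ne
      rwa [hy'i i h1 h2] at hi
  · rw [hsum]
    have := hle m
    by_cases h1 : k ≤ m
    · have h2 : j ≤ m := hjk.le.trans h1
      simp only [Finset.mem_Iic, h1, h2, if_true]; linarith
    by_cases h2 : j ≤ m
    · simp only [Finset.mem_Iic, h1, h2, if_true, if_false, sub_zero]
      -- For `j ≤ m < k` the partial sum grows by `d`. There is room for it: no index before `k` has
      -- `y` above `x`, so the slack is at least its term at `j`.
      have h3 : d ≤ ∑ i ∈ Finset.Iic m, (x i - y i) := by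
        refine hd1.trans (Finset.single_le_sum (f := fun i => x i - y i) (fun i hi => ?_)
          (Finset.mem_Iic.2 h2))
        have := hkmin i (lt_of_le_of_lt (Finset.mem_Iic.1 hi) (not_le.1 h1))
        linarith
      rw [Finset.sum_sub_distrib] at h3
      linarith
    · simp only [Finset.mem_Iic, h1, h2, if_false]; linarith
  · rw [hsum, htot]; simp

/-! ### The stop-loss order -/

section StopLoss

variable {S : Type*} [MeasurableSpace S]

/-- Equal means, and smaller expected shortfalls below every level. -/
def StopLossGE (P : Measure S) (f g : S → ℝ) : Prop :=
  ∫ s, f s ∂P = ∫ s, g s ∂P ∧ ∀ c : ℝ, ∫ s, max (c - f s) 0 ∂P ≤ ∫ s, max (c - g s) 0 ∂P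

theorem integrable_shortfall {P : Measure S} [IsFiniteMeasure P] {f : S → ℝ} (hf : Integrable f P)
    (c : ℝ) : Integrable (fun s => max (c - f s) 0) P :=
  ((integrable_const c).sub hf).pos_part

/-- With `c` the supremum of `g` on `B`, the shortfall of `g` below `c` is the integral of `c - g`
over `B`, whereas that of `f` is at least the integral of `c - f` over `B`. For sets of low labels
this yields the order of partial sums. -/
theorem StopLossGE.setIntegral_le {P : Measure S} [IsProbabilityMeasure P] {f g : S → ℝ}
    (h : StopLossGE P f g) (hf : Integrable f P) (hg : Integrable g P) {B : Set S}
    (hB : MeasurableSet B) (hgB : ∀ s ∈ B, ∀ s' ∉ B, g s ≤ g s') :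
    ∫ s in B, g s ∂P ≤ ∫ s in B, f s ∂P := by
  rcases B.eq_empty_or_nonempty with rfl | hne
  · simp
  by_cases hu : B = Set.univ
  · subst hu; simp [h.1]
  obtain ⟨s₁, hs₁⟩ := (Set.ne_univ_iff_exists_notMem B).1 hu
  set c := sSup (g '' B) with hc
  have hle : ∀ s ∈ B, g s ≤ c := fun s hs =>
    le_csSup ⟨g s₁, by rintro _ ⟨t, ht, rfl⟩; exact hgB t ht s₁ hs₁⟩ ⟨s, hs, rfl⟩
  have hge : ∀ s ∉ B, c ≤ g s := fun s hs =>
    csSup_le (hne.image g) (by rintro _ ⟨t, ht, rfl⟩; exact hgB t ht s hs)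
  have h1 : ∫ s in B, (c - f s) ∂P ≤ ∫ s, max (c - f s) 0 ∂P :=
    (setIntegral_mono ((integrable_const c).sub hf).integrableOn
      (integrable_shortfall hf c).integrableOn fun s => le_max_left _ _).trans
      (setIntegral_le_integral (integrable_shortfall hf c)
        (Eventually.of_forall fun s => le_max_right _ _))
  have h2 : ∫ s, max (c - g s) 0 ∂P = ∫ s in B, (c - g s) ∂P := by
    rw [← integral_indicator hB]
    congr 1
    ext s
    by_cases hs : s ∈ B
    · simp [hs, hle s hs]
    · simp [hs, hge s hs]
  have h3 := h1.trans ((h.2 c).trans h2.le)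
  rw [integral_sub (integrable_const c).integrableOn hf.integrableOn,
    integral_sub (integrable_const c).integrableOn hg.integrableOn] at h3
  linarith

end StopLoss

/-! ### Divisibility of nonatomic measures -/

section Nonatomic

variable {S : Type*} [MeasurableSpace S] {P : Measure S}

/-- Splitting an event and keeping the smaller part at least halves its probability. -/
theorem Nonatomic.exists_subset_measure_le [IsFiniteMeasure P] (hP : Nonatomic P) {A : Set S}
    (hA : MeasurableSet A) (hA0 : 0 < P A) {ε : ℝ≥0∞} (hε : 0 < ε) :
    ∃ B, MeasurableSet B ∧ B ⊆ A ∧ 0 < P B ∧ P B ≤ ε := by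
  have half : ∀ n : ℕ, ∃ B, MeasurableSet B ∧ B ⊆ A ∧ 0 < P B ∧ 2 ^ n * P B ≤ P A := by
    intro n
    induction n with
    | zero => exact ⟨A, hA, subset_rfl, hA0, by simp⟩
    | succ n ih =>
      obtain ⟨B, hB, hBA, hB0, hBn⟩ := ih
      obtain ⟨C, hC, hCB, hC0, hCl⟩ := hP B hB hB0
      have hsum : P C + P (B \ C) = P B := by
        rw [← measure_union Set.disjoint_sdiff_right (hB.diff hC), Set.union_sdiff_cancel hCB]
      have hD0 : 0 < P (B \ C) := by
        rw [pos_iff_ne_zero]; intro h; rw [h, add_zero] at hsum; exact hCl.ne hsum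
      rcases le_total (P C) (P (B \ C)) with h | h
      · refine ⟨C, hC, hCB.trans hBA, hC0, le_trans ?_ hBn⟩
        rw [pow_succ, mul_assoc, two_mul]
        gcongr
        rw [← hsum]; gcongr
      · refine ⟨B \ C, hB.diff hC, Set.sdiff_subset.trans hBA, hD0, le_trans ?_ hBn⟩
        rw [pow_succ, mul_assoc, two_mul]
        gcongr
        rw [← hsum]; gcongr
  obtain ⟨n, hn⟩ := ENNReal.exists_nat_mul_gt hε.ne' (measure_ne_top P A)
  obtain ⟨B, hB, hBA, hB0, hBn⟩ := half n
  refine ⟨B, hB, hBA, hB0, ?_⟩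
  by_contra! h
  refine absurd (hn.trans_le ?_) (not_lt.2 hBn)
  gcongr
  exact_mod_cast Nat.lt_two_pow_self.le

/-- Sierpiński: the values of a nonatomic measure on the subsets of an event fill an interval. -/
theorem Nonatomic.exists_subset_measure_eq [IsFiniteMeasure P] (hP : Nonatomic P) {A : Set S}
    (hA : MeasurableSet A) {c : ℝ≥0∞} (hc : c ≤ P A) :
    ∃ B, MeasurableSet B ∧ B ⊆ A ∧ P B = c := by
  have hct : c ≠ ∞ := (hc.trans_lt (measure_lt_top P A)).ne
  let T := {B : Set S // MeasurableSet B ∧ B ⊆ A ∧ P B ≤ c}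
  -- Greedy exhaustion: each step realizes at least half of the largest gain possible without
  -- exceeding `c`.
  let gain (B : T) : ℝ≥0∞ := ⨆ C : {C : T // B.1 ⊆ C.1}, P (C.1.1 \ B.1)
  have hgain : ∀ B : T, ∃ C : T, B.1 ⊆ C.1 ∧ gain B ≤ 2 * P (C.1 \ B.1) := by
    intro B
    by_cases h0 : gain B = 0
    · exact ⟨B, subset_rfl, by simp [h0]⟩
    have hlt : gain B / 2 < gain B := ENNReal.half_lt_self h0
      (ne_top_of_le_ne_top (measure_ne_top P A)
        (iSup_le fun C => measure_mono (Set.sdiff_subset.trans C.1.2.2.1)))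
    obtain ⟨C, hC⟩ := lt_iSup_iff.1 hlt
    refine ⟨C.1, C.2, ?_⟩
    rw [mul_comm]
    exact (ENNReal.div_le_iff_le_mul (by simp) (by simp)).1 hC.le
  choose next hnext hnextgain using hgain
  let B : ℕ → T := fun n => next^[n] ⟨∅, MeasurableSet.empty, Set.empty_subset _, by simp⟩
  have hBsucc : ∀ n, B (n + 1) = next (B n) := fun n => Function.iterate_succ_apply' _ _ _
  have hmono : Monotone fun n => (B n).1 :=
    monotone_nat_of_le_succ fun n => by rw [hBsucc]; exact hnext _
  have hUm : MeasurableSet (⋃ n, (B n).1) := MeasurableSet.iUnion fun n => (B n).2.1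
  have hUA : (⋃ n, (B n).1) ⊆ A := Set.iUnion_subset fun n => (B n).2.2.1
  have hUc : P (⋃ n, (B n).1) ≤ c := by
    rw [hmono.measure_iUnion]; exact iSup_le fun n => (B n).2.2.2
  refine ⟨_, hUm, hUA, le_antisymm hUc ?_⟩
  by_contra! hlt
  have hrest : 0 < P (A \ ⋃ n, (B n).1) := by
    rw [measure_sdiff hUA hUm.nullMeasurableSet (measure_ne_top _ _)]
    exact tsub_pos_of_lt (hlt.trans_le hc)
  -- A piece `D` that still fits could have been added at every stage, so every increment has at
  -- least half its measure; but the increments are disjoint, hence summable.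
  obtain ⟨D, hD, hDA, hD0, hDc⟩ := hP.exists_subset_measure_le (hA.diff hUm) hrest
    (tsub_pos_of_lt hlt)
  have hdisj : ∀ n, Disjoint D (B n).1 := fun n =>
    Set.disjoint_sdiff_left.mono hDA (Set.subset_iUnion (fun n => (B n).1) n)
  have hstep : ∀ n, P D ≤ 2 * P ((B (n + 1)).1 \ (B n).1) := by
    intro n
    rw [hBsucc]
    refine le_trans ?_ (hnextgain (B n))
    have hle : P ((B n).1 ∪ D) ≤ c := by
      refine (measure_union_le _ _).trans ?_
      calc P (B n).1 + P D ≤ P (⋃ n, (B n).1) + (c - P (⋃ n, (B n).1)) := by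
            gcongr; exact Set.subset_iUnion (fun n => (B n).1) n
        _ = c := add_tsub_cancel_of_le hUc
    let C : T := ⟨(B n).1 ∪ D, (B n).2.1.union hD,
      Set.union_subset (B n).2.2.1 (hDA.trans Set.sdiff_subset), hle⟩
    refine le_trans (measure_mono ?_)
      (le_iSup (fun C : {C : T // (B n).1 ⊆ C.1} => P (C.1.1 \ (B n).1))
        ⟨C, Set.subset_union_left⟩)
    exact fun s hs => ⟨Or.inr hs, fun h => (hdisj n).ne_of_mem hs h rfl⟩
  have hsum : ∑' n, P ((B (n + 1)).1 \ (B n).1) ≠ ∞ := by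
    rw [← measure_iUnion _ fun n => (B (n + 1)).2.1.diff (B n).2.1]
    · exact measure_ne_top _ _
    · intro m n hmn
      wlog h : m < n generalizing m n
      · exact (this hmn.symm (lt_of_le_of_ne (not_lt.1 h) hmn.symm)).symm
      exact Set.disjoint_left.2 fun s hs hs' => hs'.2 (hmono (Nat.succ_le_of_lt h) hs.1)
  have htend := ENNReal.Tendsto.const_mul (a := 2) (ENNReal.tendsto_atTop_zero_of_tsum_ne_top hsum)
    (Or.inr (by simp))
  rw [mul_zero] at htend
  exact hD0.not_ge (ge_of_tendsto' htend hstep)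

/-- A nonatomic probability space is cut into ever finer pieces by a sequence of halvings. -/
theorem Nonatomic.exists_dyadic_labels [IsProbabilityMeasure P] (hP : Nonatomic P) :
    ∃ κ : ℕ → S → ℕ, (∀ n, Measurable (κ n)) ∧ (∀ n s, κ (n + 1) s / 2 = κ n s) ∧
      (∀ n s, κ n s < 2 ^ n) ∧ ∀ n k, k < 2 ^ n → P (κ n ⁻¹' {k}) = (2 ^ n)⁻¹ := by
  have hhalf : ∀ A : Set S, ∃ B, MeasurableSet A → MeasurableSet B ∧ B ⊆ A ∧ P B = P A / 2 := by
    intro A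
    by_cases hA : MeasurableSet A
    · obtain ⟨B, hB⟩ := hP.exists_subset_measure_eq hA (ENNReal.half_le_self (a := P A))
      exact ⟨B, fun _ => hB⟩
    · exact ⟨∅, fun h => absurd h hA⟩
  choose half hhalf using hhalf
  classical
  -- The binary digit `0` is appended on the chosen half of the current cell and `1` on the rest.
  let next (κ : S → ℕ) : S → ℕ := fun s => 2 * κ s + if s ∈ half (κ ⁻¹' {κ s}) then 0 else 1
  let κ : ℕ → S → ℕ := fun n => next^[n] fun _ => 0
  have hκ : ∀ n s, κ (n + 1) s = 2 * κ n s + if s ∈ half (κ n ⁻¹' {κ n s}) then 0 else 1 :=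
    fun n s => congrFun (Function.iterate_succ_apply' next n _) s
  have heven : ∀ n, Measurable (κ n) → ∀ k, κ (n + 1) ⁻¹' {2 * k} = half (κ n ⁻¹' {k}) := by
    intro n hn k
    ext s
    simp only [Set.mem_preimage, Set.mem_singleton_iff, hκ]
    constructor
    · intro h
      split_ifs at h with h'
      · rwa [show κ n s = k by omega] at h'
      · omega
    · intro h
      have : κ n s = k := ((hhalf _) (hn (measurableSet_singleton k))).2.1 h
      rw [this, if_pos h]; omega
  have hodd : ∀ n, Measurable (κ n) → ∀ k,
      κ (n + 1) ⁻¹' {2 * k + 1} = (κ n ⁻¹' {k}) \ half (κ n ⁻¹' {k}) := by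
    intro n hn k
    ext s
    simp only [Set.mem_preimage, Set.mem_singleton_iff, hκ, Set.mem_sdiff]
    constructor
    · intro h
      split_ifs at h with h'
      · omega
      · have : κ n s = k := by omega
        exact ⟨this, by rwa [this] at h'⟩
    · rintro ⟨h, h'⟩
      rw [h, if_neg h']
  have hmeas : ∀ n, Measurable (κ n) := by
    intro n
    induction n with
    | zero => exact measurable_const
    | succ n ih =>
      refine measurable_to_countable' fun m => ?_
      have h := fun k => (hhalf _) (ih (measurableSet_singleton k))
      rcases Nat.even_or_odd' m with ⟨k, rfl | rfl⟩
      · rw [heven n ih]; exact (h k).1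
      · rw [hodd n ih]; exact (ih (measurableSet_singleton k)).diff (h k).1
  refine ⟨κ, hmeas, fun n s => by rw [hκ]; split_ifs <;> omega, fun n s => ?_, fun n => ?_⟩
  · induction n with
    | zero => simp [κ]
    | succ n ih => rw [hκ, pow_succ]; split_ifs <;> omega
  induction n with
  | zero =>
    intro k hk
    obtain rfl : k = 0 := by simpa using hk
    have : κ 0 ⁻¹' {0} = Set.univ := by ext s; simp [κ]
    simp [this]
  | succ n ih =>
    intro m hm
    have h := fun k => (hhalf _) (hmeas n (measurableSet_singleton k))
    have hpow : ((2 : ℝ≥0∞) ^ n)⁻¹ / 2 = (2 ^ (n + 1))⁻¹ := by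
      rw [pow_succ, ENNReal.mul_inv (by simp) (by simp), div_eq_mul_inv]
    rw [pow_succ] at hm
    rcases Nat.even_or_odd' m with ⟨k, rfl | rfl⟩
    · rw [heven n (hmeas n), (h k).2.2, ih k (by omega), hpow]
    · rw [hodd n (hmeas n), measure_sdiff (h k).2.1 (h k).1.nullMeasurableSet (measure_ne_top _ _),
        (h k).2.2, ENNReal.sub_half (measure_ne_top _ _), ih k (by omega), hpow]

end Nonatomic

/-! ### Uniform variables, equally likely labels and quantiles -/

section Uniform

variable {S : Type*} [MeasurableSpace S] {P : Measure S}

/-- The dyadic labels are successive binary truncations of a number in the unit interval; the cell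
probabilities determine its distribution function. -/
theorem Nonatomic.exists_uniform [IsProbabilityMeasure P] (hP : Nonatomic P) :
    ∃ U : S → ℝ, Measurable U ∧ (∀ s, U s ∈ Set.Ioo (0 : ℝ) 1) ∧
      P.map U = volume.restrict (Set.Ioo (0 : ℝ) 1) := by
  obtain ⟨κ, hκm, hκ2, hκlt, hκP⟩ := hP.exists_dyadic_labels
  have hpow : ∀ n : ℕ, (0 : ℝ) < 2 ^ n := fun n => by positivity
  have hmono : ∀ s, Monotone fun n => (κ n s : ℝ) / 2 ^ n := fun s =>
    monotone_nat_of_le_succ fun n => by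
      rw [div_le_div_iff₀ (hpow _) (hpow _), pow_succ]
      have : 2 * κ n s ≤ κ (n + 1) s := by have := hκ2 n s; omega
      have : 2 * (κ n s : ℝ) ≤ κ (n + 1) s := by exact_mod_cast this
      nlinarith [hpow n]
  have hanti : ∀ s, Antitone fun n => ((κ n s : ℝ) + 1) / 2 ^ n := fun s =>
    antitone_nat_of_succ_le fun n => by
      rw [div_le_div_iff₀ (hpow _) (hpow _), pow_succ]
      have : κ (n + 1) s + 1 ≤ 2 * (κ n s + 1) := by have := hκ2 n s; omega
      have : (κ (n + 1) s : ℝ) + 1 ≤ 2 * (κ n s + 1) := by exact_mod_cast this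
      nlinarith [hpow n]
  have hle : ∀ s m n, (κ m s : ℝ) / 2 ^ m ≤ ((κ n s : ℝ) + 1) / 2 ^ n := fun s m n =>
    (hmono s (le_max_left m n)).trans (le_trans
      (div_le_div_of_nonneg_right (le_add_of_nonneg_right zero_le_one) (hpow _).le)
      (hanti s (le_max_right m n)))
  have hbdd : ∀ s, BddAbove (Set.range fun n => (κ n s : ℝ) / 2 ^ n) := fun s =>
    ⟨_, by rintro _ ⟨m, rfl⟩; exact hle s m 0⟩
  let V : S → ℝ := fun s => ⨆ n, (κ n s : ℝ) / 2 ^ n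
  have hVm : Measurable V := Measurable.iSup fun n =>
    ((measurable_of_countable (fun k : ℕ => (k : ℝ))).comp (hκm n)).div_const _
  have hVge : ∀ s n, (κ n s : ℝ) / 2 ^ n ≤ V s := fun s n => le_ciSup (hbdd s) n
  have hVle : ∀ s n, V s ≤ ((κ n s : ℝ) + 1) / 2 ^ n := fun s n => ciSup_le fun m => hle s m n
  have hcount : ∀ n k, k ≤ 2 ^ n → P.real {s | κ n s < k} = k / 2 ^ n := by
    intro n k
    induction k with
    | zero => simp
    | succ k ih =>
      intro hk
      have hset : {s | κ n s < k + 1} = {s | κ n s < k} ∪ κ n ⁻¹' {k} := by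
        ext s; simp [← le_iff_lt_or_eq]
      rw [hset, measureReal_union _ (hκm n (measurableSet_singleton k)), ih (by omega),
        measureReal_def, hκP n k (by omega)]
      · simp; ring
      · exact Set.disjoint_left.2 fun s hs hs' => (ne_of_lt hs) hs'
  have hcdf : ∀ t : ℝ, 0 ≤ t → t < 1 → P.real {s | V s ≤ t} = t := by
    intro t ht0 ht1
    -- The event `V ≤ t` lies between the unions of the lowest `⌊2 ^ n * t⌋₊` and `⌊2 ^ n * t⌋₊ + 1`
    -- cells.
    have hbound : ∀ n : ℕ, |P.real {s | V s ≤ t} - t| ≤ (1 / 2 : ℝ) ^ n := by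
      intro n
      have hf1 : (⌊2 ^ n * t⌋₊ : ℝ) ≤ 2 ^ n * t := Nat.floor_le (by positivity)
      have hf2 : 2 ^ n * t < ⌊2 ^ n * t⌋₊ + 1 := Nat.lt_floor_add_one _
      have hf3 : ⌊2 ^ n * t⌋₊ < 2 ^ n := by
        have : (⌊2 ^ n * t⌋₊ : ℝ) < 2 ^ n := by nlinarith [hpow n]
        exact_mod_cast this
      have h1 : P.real {s | κ n s < ⌊2 ^ n * t⌋₊} ≤ P.real {s | V s ≤ t} := by
        refine measureReal_mono fun s hs => (hVle s n).trans ?_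
        rw [div_le_iff₀ (hpow n)]
        have : (κ n s : ℝ) + 1 ≤ ⌊2 ^ n * t⌋₊ := by exact_mod_cast hs
        linarith
      have h2 : P.real {s | V s ≤ t} ≤ P.real {s | κ n s < ⌊2 ^ n * t⌋₊ + 1} := by
        refine measureReal_mono fun s hs => ?_
        have h3 := (div_le_iff₀ (hpow n)).1 ((hVge s n).trans hs)
        have : (κ n s : ℝ) < ⌊2 ^ n * t⌋₊ + 1 := by linarith
        exact_mod_cast this
      rw [hcount n _ hf3.le, div_le_iff₀ (hpow n)] at h1
      rw [hcount n _ hf3, le_div_iff₀ (hpow n)] at h2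
      push_cast at h2
      rw [one_div, inv_pow, ← one_div, le_div_iff₀ (hpow n)]
      rw [← abs_of_pos (hpow n), ← abs_mul, abs_le]
      constructor <;> nlinarith
    have h0 : |P.real {s | V s ≤ t} - t| ≤ 0 :=
      ge_of_tendsto' (tendsto_pow_atTop_nhds_zero_of_lt_one (by norm_num) (by norm_num)) hbound
    exact sub_eq_zero.1 (abs_nonpos_iff.1 h0)
  have hV0 : ∀ s, 0 ≤ V s := fun s => le_trans (by positivity) (hVge s 0)
  have hV1 : ∀ s, V s ≤ 1 := fun s => (hVle s 0).trans (by have := hκlt 0 s; simp_all)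
  have hlaw : P.map V = volume.restrict (Set.Ioo (0 : ℝ) 1) := by
    have := Measure.isProbabilityMeasure_map (μ := P) hVm.aemeasurable
    rw [restrict_Ioo_eq_restrict_Ioc]
    refine Measure.ext_of_Iic _ _ fun t => ?_
    rw [Measure.map_apply hVm measurableSet_Iic, Measure.restrict_apply measurableSet_Iic,
      Set.inter_comm, Set.Ioc_inter_Iic, Real.volume_Ioc, sub_zero]
    change P {s | V s ≤ t} = _
    rcases lt_or_ge t 0 with h | h
    · rw [ENNReal.ofReal_of_nonpos (by simp [h.le])]
      convert measure_empty (μ := P)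
      ext s; simpa using h.trans_le (hV0 s)
    rcases lt_or_ge t 1 with h' | h'
    · rw [inf_of_le_right h'.le, ← ofReal_measureReal, hcdf t h h']
    · rw [inf_of_le_left h']
      have : {s | V s ≤ t} = Set.univ := by ext s; simpa using (hV1 s).trans h'
      simp [this]
  have hae : ∀ᵐ s ∂P, V s ∈ Set.Ioo (0 : ℝ) 1 := by
    refine ae_of_ae_map hVm.aemeasurable (p := fun u => u ∈ Set.Ioo (0 : ℝ) 1) ?_
    rw [hlaw]; exact ae_restrict_mem measurableSet_Ioo
  classical
  -- The endpoints have probability zero. Resetting them to `1 / 2` puts every value in the open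
  -- interval, where quantile functions are monotone.
  let U : S → ℝ := fun s => if V s ∈ Set.Ioo (0 : ℝ) 1 then V s else 1 / 2
  refine ⟨U, hVm.ite (hVm measurableSet_Ioo) measurable_const, fun s => ?_, ?_⟩
  · by_cases h : V s ∈ Set.Ioo (0 : ℝ) 1
    · simpa only [U, if_pos h] using h
    · simp only [U, if_neg h]; norm_num
  · rw [← hlaw]
    refine Measure.map_congr ?_
    filter_upwards [hae] with s hs
    simp only [U, if_pos hs]

/-- A measurable labelling of the states by `Fin N` with equally likely labels. -/
def IsUniformLabel (P : Measure S) {N : ℕ} (κ : S → Fin N) : Prop :=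
  Measurable κ ∧ ∀ i, P (κ ⁻¹' {i}) = (N : ℝ≥0∞)⁻¹

theorem exists_uniformLabel_of_uniform {U : S → ℝ} (hUm : Measurable U)
    (hU : ∀ s, U s ∈ Set.Ioo (0 : ℝ) 1) (hlaw : P.map U = volume.restrict (Set.Ioo (0 : ℝ) 1))
    {N : ℕ} (hN : 0 < N) :
    ∃ κ : S → Fin N, IsUniformLabel P κ ∧ ∀ s, (κ s : ℕ) = ⌊N * U s⌋₊ := by
  have hN' : (0 : ℝ) < N := by exact_mod_cast hN
  have hlt : ∀ s, ⌊N * U s⌋₊ < N := fun s => by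
    rw [Nat.floor_lt (mul_nonneg hN'.le (hU s).1.le)]
    nlinarith [(hU s).2]
  refine ⟨fun s => ⟨⌊N * U s⌋₊, hlt s⟩, ?_, fun s => rfl⟩
  have hpre : ∀ i : Fin N, (fun s => (⟨⌊N * U s⌋₊, hlt s⟩ : Fin N)) ⁻¹' {i} =
      U ⁻¹' Set.Ico ((i : ℝ) / N) (((i : ℝ) + 1) / N) := by
    intro i
    ext s
    simp only [Set.mem_preimage, Set.mem_singleton_iff, Fin.ext_iff, Set.mem_Ico]
    rw [Nat.floor_eq_iff (mul_nonneg hN'.le (hU s).1.le), div_le_iff₀ hN', lt_div_iff₀ hN',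
      mul_comm (U s)]
  refine ⟨measurable_to_countable' fun i => ?_, fun i => ?_⟩
  · rw [hpre]; exact hUm measurableSet_Ico
  · rw [hpre, ← Measure.map_apply hUm measurableSet_Ico, hlaw, restrict_Ioo_eq_restrict_Ico,
      Measure.restrict_apply measurableSet_Ico, Set.inter_eq_left.2, Real.volume_Ico, ← sub_div,
      add_sub_cancel_left, one_div, ENNReal.ofReal_inv_of_pos hN', ENNReal.ofReal_natCast]
    have hi : (i : ℝ) + 1 ≤ N := by exact_mod_cast i.2
    exact Set.Ico_subset_Ico (by positivity) ((div_le_one hN').2 hi)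

/-- Every law on the line is the law of a monotone function of a uniform variable. -/
theorem exists_quantile (μ : Measure ℝ) [IsProbabilityMeasure μ] :
    ∃ q : ℝ → ℝ, Measurable q ∧ MonotoneOn q (Set.Ioo 0 1) ∧
      (volume.restrict (Set.Ioo (0 : ℝ) 1)).map q = μ := by
  classical
  let q : ℝ → ℝ := fun u =>
    if u ∈ Set.Ioo (0 : ℝ) 1 then sInf {x | u ≤ ProbabilityTheory.cdf μ x} else 0
  -- The quantile function is the lower adjoint of the distribution function; right continuity makes
  -- the infimum attained.
  have hgc : ∀ u ∈ Set.Ioo (0 : ℝ) 1, ∀ x, q u ≤ x ↔ u ≤ ProbabilityTheory.cdf μ x := by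
    intro u hu x
    simp only [q, if_pos hu]
    obtain ⟨a, ha⟩ := ((ProbabilityTheory.tendsto_cdf_atBot μ).eventually_lt_const hu.1).exists
    obtain ⟨b, hb⟩ := ((ProbabilityTheory.tendsto_cdf_atTop μ).eventually_const_lt hu.2).exists
    have hbdd : BddBelow {x | u ≤ ProbabilityTheory.cdf μ x} := by
      refine ⟨a, fun y hy => ?_⟩
      by_contra! h
      exact absurd ((ProbabilityTheory.monotone_cdf μ h.le).trans_lt ha) (not_lt.2 hy)
    refine ⟨fun h => ?_, fun h => csInf_le hbdd h⟩
    have hlim : Tendsto (ProbabilityTheory.cdf μ) (𝓝[>] x) (𝓝 (ProbabilityTheory.cdf μ x)) :=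
      ((ProbabilityTheory.cdf μ).right_continuous x).tendsto.mono_left
        (nhdsWithin_mono _ Set.Ioi_subset_Ici_self)
    refine ge_of_tendsto hlim ?_
    filter_upwards [self_mem_nhdsWithin] with y hy
    obtain ⟨z, hz, hzy⟩ := exists_lt_of_csInf_lt ⟨b, hb.le⟩ (h.trans_lt hy)
    exact le_trans hz (ProbabilityTheory.monotone_cdf μ hzy.le)
  have hpre : ∀ x, q ⁻¹' Set.Iic x ∩ Set.Ioo 0 1 =
      Set.Iic (ProbabilityTheory.cdf μ x) ∩ Set.Ioo 0 1 := by
    intro x; ext u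
    simp only [Set.mem_inter_iff, Set.mem_preimage, Set.mem_Iic]
    exact and_congr_left fun hu => hgc u hu x
  have hqm : Measurable q := by
    refine measurable_of_Iic fun x => ?_
    rw [← Set.inter_union_compl (q ⁻¹' Set.Iic x) (Set.Ioo 0 1), hpre]
    refine (measurableSet_Iic.inter measurableSet_Ioo).union ?_
    by_cases hx : 0 ≤ x
    · convert (measurableSet_Ioo (a := (0 : ℝ)) (b := 1)).compl using 1
      refine Set.inter_eq_right.2 fun u hu => ?_
      simpa only [q, Set.mem_preimage, if_neg hu, Set.mem_Iic] using hx
    · convert MeasurableSet.empty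
      refine Set.eq_empty_of_forall_notMem fun u hu => hx ?_
      simpa only [q, Set.mem_preimage, if_neg hu.2, Set.mem_Iic] using hu.1
  refine ⟨q, hqm, fun u hu v hv huv => (hgc u hu _).2 (huv.trans ((hgc v hv _).1 le_rfl)), ?_⟩
  have : IsProbabilityMeasure (volume.restrict (Set.Ioo (0 : ℝ) 1)) := ⟨by simp⟩
  have := Measure.isProbabilityMeasure_map (μ := volume.restrict (Set.Ioo (0 : ℝ) 1))
    hqm.aemeasurable
  refine Measure.ext_of_Iic _ _ fun x => ?_
  rw [Measure.map_apply hqm measurableSet_Iic, Measure.restrict_apply (hqm measurableSet_Iic),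
    hpre, ← Measure.restrict_apply measurableSet_Iic, restrict_Ioo_eq_restrict_Ioc,
    Measure.restrict_apply measurableSet_Iic, Set.inter_comm, Set.Ioc_inter_Iic, Real.volume_Ioc,
    sub_zero, inf_of_le_right (ProbabilityTheory.cdf_le_one μ x), ProbabilityTheory.ofReal_cdf]

end Uniform

/-! ### Averages over equally likely cells -/

section LabelAverage

variable {S : Type*} [MeasurableSpace S] {P : Measure S} {N : ℕ} {κ : S → Fin N}

/-- The average of `f` over the states with label `i`. -/
noncomputable def labelAverage (P : Measure S) (κ : S → Fin N) (f : S → ℝ) (i : Fin N) : ℝ :=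
  N * ∫ s in κ ⁻¹' {i}, f s ∂P

theorem IsUniformLabel.measureReal (hκ : IsUniformLabel P κ) (i : Fin N) :
    P.real (κ ⁻¹' {i}) = (N : ℝ)⁻¹ := by
  rw [measureReal_def, hκ.2, ENNReal.toReal_inv, ENNReal.toReal_natCast]

theorem labelAverage_comp (hκ : IsUniformLabel P κ) (x : Fin N → ℝ) :
    labelAverage P κ (fun s => x (κ s)) = x := by
  ext i
  have hN : (N : ℝ) ≠ 0 := by have := i.pos; positivity
  rw [labelAverage, setIntegral_congr_fun (g := fun _ => x i) (hκ.1 (measurableSet_singleton i))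
    (fun s hs => by rw [Set.mem_preimage, Set.mem_singleton_iff] at hs; simp only [hs]),
    setIntegral_const, hκ.measureReal, smul_eq_mul, mul_inv_cancel_left₀ hN]

theorem sum_labelAverage [IsFiniteMeasure P] (hκ : Measurable κ) {f : S → ℝ}
    (hf : Integrable f P) (T : Finset (Fin N)) :
    ∑ i ∈ T, labelAverage P κ f i = N * ∫ s in κ ⁻¹' T, f s ∂P := by
  have h : κ ⁻¹' (T : Set (Fin N)) = ⋃ i ∈ T, κ ⁻¹' {i} := by ext s; simp
  rw [h, integral_biUnion_finset T (fun i _ => hκ (measurableSet_singleton i)) ?_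
    (fun i _ => hf.integrableOn), Finset.mul_sum]
  · rfl
  · intro i _ j _ hij
    exact Disjoint.preimage κ (Set.disjoint_singleton.2 hij)

theorem monotone_labelAverage [IsFiniteMeasure P] (hκ : IsUniformLabel P κ) {f : S → ℝ}
    (hf : Integrable f P) (hsorted : ∀ s s', κ s < κ s' → f s ≤ f s') :
    Monotone (labelAverage P κ f) := by
  intro i j hij
  rcases hij.eq_or_lt with rfl | hij
  · rfl
  have hN : (N : ℝ) ≠ 0 := by have := i.pos; positivity
  have hm := fun i => hκ.1 (measurableSet_singleton i)
  have h1 : ∀ s' ∈ κ ⁻¹' {j}, labelAverage P κ f i ≤ f s' := by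
    intro s' hs'
    have := setIntegral_mono_on hf.integrableOn (integrable_const (f s')).integrableOn (hm i)
      (fun s hs => hsorted s s' (by
        rw [Set.mem_preimage, Set.mem_singleton_iff] at hs hs'; rwa [hs, hs']))
    rw [setIntegral_const, hκ.measureReal, smul_eq_mul] at this
    calc labelAverage P κ f i ≤ N * ((N : ℝ)⁻¹ * f s') :=
          mul_le_mul_of_nonneg_left this (Nat.cast_nonneg N)
      _ = f s' := mul_inv_cancel_left₀ hN _
  have := setIntegral_mono_on (integrable_const (labelAverage P κ f i)).integrableOn
    hf.integrableOn (hm j) h1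
  rw [setIntegral_const, hκ.measureReal, smul_eq_mul] at this
  calc labelAverage P κ f i = N * ((N : ℝ)⁻¹ * labelAverage P κ f i) :=
        (mul_inv_cancel_left₀ hN _).symm
    _ ≤ labelAverage P κ f j := mul_le_mul_of_nonneg_left this (Nat.cast_nonneg N)

theorem StopLossGE.sum_labelAverage_le [IsProbabilityMeasure P] (hκ : Measurable κ)
    {f g : S → ℝ} (h : StopLossGE P f g) (hf : Integrable f P) (hg : Integrable g P)
    (hsorted : ∀ s s', κ s < κ s' → g s ≤ g s') (m : Fin N) :
    ∑ i ∈ Finset.Iic m, labelAverage P κ g i ≤ ∑ i ∈ Finset.Iic m, labelAverage P κ f i := by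
  rw [sum_labelAverage hκ hf, sum_labelAverage hκ hg]
  refine mul_le_mul_of_nonneg_left (h.setIntegral_le hf hg (hκ (Finset.measurableSet _)) ?_)
    (Nat.cast_nonneg N)
  intro s hs s' hs'
  simp only [Finset.coe_Iic, Set.mem_preimage, Set.mem_Iic, not_le] at hs hs'
  exact hsorted s s' (hs.trans_lt hs')

/-- The conditional expectation is a function `h` of the label and has the same cell averages as
`f`; the averages of a function of the label are its values. -/
theorem condExp_comap_label [IsProbabilityMeasure P] (hκ : IsUniformLabel P κ) {f : S → ℝ}
    (hf : Integrable f P) :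
    P[f | MeasurableSpace.comap κ ⊤] = fun s => labelAverage P κ f (κ s) := by
  obtain ⟨h, -, hh⟩ := (stronglyMeasurable_condExp (μ := P) (f := f)
    (m := MeasurableSpace.comap κ ⊤)).exists_eq_measurable_comp
  have hav : labelAverage P κ f = h := by
    ext i
    rw [labelAverage, ← setIntegral_condExp (m := MeasurableSpace.comap κ ⊤) hκ.1.comap_le hf
      ⟨{i}, trivial, rfl⟩, hh]
    exact congrFun (labelAverage_comp hκ h) i
  rw [hav, hh]
  rfl

end LabelAverage

/-! ### Sorted martingale approximation -/

section Approximation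

variable {S : Type*} [MeasurableSpace S] {P : Measure S}

/-- Interpolation: `|h| ^ p` is at most `K ^ (p - 1) * |h|` where `|h| ≤ K` and at most `|h| ^ (p +
1) / K` elsewhere. A large `K` makes the second part uniformly small. -/
theorem tendsto_integral_abs_pow_of_tendsto_integral_abs [IsFiniteMeasure P] {h : ℕ → S → ℝ}
    {p : ℕ} (hp : 1 ≤ p) {M : ℝ} (hint : ∀ n, Integrable (fun s => |h n s|) P)
    (hintp : ∀ n, Integrable (fun s => |h n s| ^ (p + 1)) P)
    (hM : ∀ n, ∫ s, |h n s| ^ (p + 1) ∂P ≤ M)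
    (hlim : Tendsto (fun n => ∫ s, |h n s| ∂P) atTop (𝓝 0)) :
    Tendsto (fun n => ∫ s, |h n s| ^ p ∂P) atTop (𝓝 0) := by
  have hM0 : 0 ≤ M := le_trans (integral_nonneg fun s => by positivity) (hM 0)
  have hbound : ∀ K : ℝ, 0 < K → ∀ n,
      ∫ s, |h n s| ^ p ∂P ≤ K ^ (p - 1) * ∫ s, |h n s| ∂P + M / K := by
    intro K hK n
    calc ∫ s, |h n s| ^ p ∂P ≤ ∫ s, (K ^ (p - 1) * |h n s| + |h n s| ^ (p + 1) / K) ∂P := by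
          refine integral_mono_of_nonneg (Eventually.of_forall fun s => by positivity)
            (((hint n).const_mul _).add ((hintp n).div_const K)) (Eventually.of_forall fun s => ?_)
          have h0 := abs_nonneg (h n s)
          obtain ⟨r, rfl⟩ := Nat.exists_eq_add_of_le' hp
          simp only [Nat.add_sub_cancel]
          rcases le_total |h n s| K with hle | hle
          · have h1 : |h n s| ^ (r + 1) ≤ K ^ r * |h n s| := by
              rw [pow_succ]; gcongr
            have h2 : 0 ≤ |h n s| ^ (r + 1 + 1) / K := by positivity
            linarith
          · have h1 : |h n s| ^ (r + 1) ≤ |h n s| ^ (r + 1 + 1) / K := by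
              rw [le_div_iff₀ hK, pow_succ _ (r + 1)]; gcongr
            have h2 : 0 ≤ K ^ r * |h n s| := by positivity
            linarith
      _ = K ^ (p - 1) * ∫ s, |h n s| ∂P + (∫ s, |h n s| ^ (p + 1) ∂P) / K := by
          rw [integral_add ((hint n).const_mul _) ((hintp n).div_const K), integral_const_mul,
            integral_div]
      _ ≤ _ := by gcongr; exact hM n
  rw [Metric.tendsto_atTop]
  intro ε hε
  set K := 2 * (M + 1) / ε with hKdef
  have hK : 0 < K := by positivity
  have hMK : M / K < ε / 2 := by
    rw [div_lt_iff₀ hK, hKdef]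
    have : ε / 2 * (2 * (M + 1) / ε) = M + 1 := by field_simp
    linarith
  have hlim' := hlim.const_mul (K ^ (p - 1))
  rw [mul_zero] at hlim'
  obtain ⟨n₀, hn₀⟩ := Metric.tendsto_atTop.1 hlim' (ε / 2) (by positivity)
  refine ⟨n₀, fun n hn => ?_⟩
  have h1 := hn₀ n hn
  rw [Real.dist_eq, sub_zero] at h1 ⊢
  rw [abs_of_nonneg (integral_nonneg fun s => by positivity)]
  have h2 := le_abs_self (K ^ (p - 1) * ∫ s, |h n s| ∂P)
  have h3 := hbound K hK n
  linarith

/-- On a nonatomic space there are refining uniform labellings such that every integrable law is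
realized by a variable that is sorted along them and is the limit of its averages. -/
theorem Nonatomic.exists_sorted_approximation [IsProbabilityMeasure P] (hP : Nonatomic P) :
    ∃ κ : ∀ n : ℕ, S → Fin (2 ^ n), (∀ n, IsUniformLabel P (κ n)) ∧
      ∀ f : S → ℝ, Measurable f → Integrable f P → ∃ f' : S → ℝ, Measurable f' ∧
        EqDistr P f' f ∧ (∀ n s s', κ n s < κ n s' → f' s ≤ f' s') ∧
        (∀ᵐ s ∂P, Tendsto (fun n => labelAverage P (κ n) f' (κ n s)) atTop (𝓝 (f' s))) ∧
        Tendsto (fun n => ∫ s, |labelAverage P (κ n) f' (κ n s) - f' s| ∂P) atTop (𝓝 0) := by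
  obtain ⟨U, hUm, hU, hlaw⟩ := hP.exists_uniform
  choose κ hκ hκU using fun n : ℕ =>
    exists_uniformLabel_of_uniform hUm hU hlaw (N := 2 ^ n) (by positivity)
  refine ⟨κ, hκ, fun f hfm hfi => ?_⟩
  have := Measure.isProbabilityMeasure_map (μ := P) hfm.aemeasurable
  obtain ⟨q, hqm, hqmono, hq⟩ := exists_quantile (P.map f)
  have hf'm : Measurable fun s => q (U s) := hqm.comp hUm
  have hdist : EqDistr P (fun s => q (U s)) f := by
    rw [EqDistr, ← hq, ← hlaw, Measure.map_map hqm hUm]; rfl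
  have hf'i : Integrable (fun s => q (U s)) P :=
    (ProbabilityTheory.IdentDistrib.integrable_iff
      ⟨hf'm.aemeasurable, hfm.aemeasurable, hdist⟩).2 hfi
  have hstep : ∀ n s, (κ n s : ℕ) = κ (n + 1) s / 2 := by
    intro n s
    have h2 : ((2 ^ n : ℕ) : ℝ) * U s = ((2 ^ (n + 1) : ℕ) : ℝ) * U s / (2 : ℕ) := by
      push_cast; ring
    rw [hκU, hκU, h2, Nat.floor_div_natCast]
  let ℱ : Filtration ℕ ‹MeasurableSpace S› :=
    { seq := fun n => MeasurableSpace.comap (κ n) ⊤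
      mono' := monotone_nat_of_le_succ fun n => by
        have : κ n = (fun i : Fin (2 ^ (n + 1)) =>
            (⟨i / 2, by have := i.2; have := pow_succ 2 n; omega⟩ : Fin (2 ^ n))) ∘ κ (n + 1) := by
          ext s; exact hstep n s
        rw [this, ← MeasurableSpace.comap_comp]
        exact MeasurableSpace.comap_mono le_top
      le' := fun n => (hκ n).1.comap_le }
  -- `U` is the limit of `⌊2 ^ n * U⌋₊ / 2 ^ n`, so the labels generate it and Lévy's upward theorem
  -- applies to `q (U s)`.
  have hUℱ : Measurable[⨆ n, ℱ n] U := by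
    have hpow : Tendsto (fun n : ℕ => (2 : ℝ) ^ n) atTop atTop :=
      tendsto_pow_atTop_atTop_of_one_lt one_lt_two
    refine @measurable_of_tendsto_metrizable S ℝ (⨆ n, ℱ n) _ _ _ _
      (fun n s => ((κ n s : ℕ) : ℝ) / 2 ^ n) U (fun n => ?_) (tendsto_pi_nhds.2 fun s => ?_)
    · have h1 : Measurable[ℱ n] fun s => ((κ n s : ℕ) : ℝ) / 2 ^ n :=
        (measurable_from_top (f := fun i : Fin (2 ^ n) => ((i : ℕ) : ℝ) / 2 ^ n)).comp
          (comap_measurable (κ n))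
      exact h1.mono (le_iSup (fun n => (ℱ n : MeasurableSpace S)) n) le_rfl
    · refine ((tendsto_nat_floor_mul_div_atTop (hU s).1.le).comp hpow).congr fun n => ?_
      simp only [Function.comp_apply, hκU, Nat.cast_pow, Nat.cast_ofNat, mul_comm]
  have hmeas : StronglyMeasurable[⨆ n, ℱ n] fun s => q (U s) :=
    (hqm.comp hUℱ).stronglyMeasurable
  have hcond : ∀ n, P[fun s => q (U s) | ℱ n] =
      fun s => labelAverage P (κ n) (fun s => q (U s)) (κ n s) :=
    fun n => condExp_comap_label (hκ n) hf'i
  refine ⟨fun s => q (U s), hf'm, hdist, fun n s s' hss' => hqmono (hU s) (hU s') ?_, ?_, ?_⟩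
  · by_contra! h
    have h1 : (κ n s' : ℕ) ≤ κ n s := by
      rw [hκU, hκU]; exact Nat.floor_le_floor (by gcongr)
    exact absurd (Fin.lt_def.1 hss') (not_lt.2 h1)
  · filter_upwards [hf'i.tendsto_ae_condExp hmeas] with s hs
    simpa only [hcond] using hs
  · have h := (ENNReal.tendsto_toReal ENNReal.zero_ne_top).comp
      (hf'i.tendsto_eLpNorm_condExp hmeas)
    simp only [ENNReal.toReal_zero] at h
    refine h.congr fun n => ?_
    have hi : Integrable (P[fun s => q (U s) | ℱ n] - fun s => q (U s)) P :=
      integrable_condExp.sub hf'i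
    rw [Function.comp_apply, eLpNorm_one_eq_lintegral_enorm, ← integral_norm_eq_lintegral_enorm
      hi.aestronglyMeasurable]
    simp only [hcond, Pi.sub_apply, Real.norm_eq_abs]

end Approximation

/-! ### Payoffs and rearrangements -/

section PayoffSpace

variable {S : Type*} [MeasurableSpace S] {P : Measure S} {F : Submodule ℝ (S → ℝ)}

theorem memLp_of_mem [IsFiniteMeasure P] (hF : F = LInfty P ∨ F = MInfty P) {f : S → ℝ}
    (hf : f ∈ F) : Measurable f ∧ ∀ p : ℕ, MemLp f p P := by
  rcases hF with rfl | rfl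
  · exact ⟨hf.1, fun p => hf.2.mono_exponent le_top⟩
  · exact hf

theorem integrable_of_mem [IsFiniteMeasure P] (hF : F = LInfty P ∨ F = MInfty P) {f : S → ℝ}
    (hf : f ∈ F) : Integrable f P := by
  simpa using memLp_one_iff_integrable.1 (by simpa using (memLp_of_mem hF hf).2 1)

theorem mem_of_eqDistr (hF : F = LInfty P ∨ F = MInfty P) {f g : S → ℝ} (hf : f ∈ F)
    (hg : Measurable g) (hgf : EqDistr P g f) : g ∈ F := by
  rcases hF with rfl | rfl
  · have h : ProbabilityTheory.IdentDistrib g f P P := ⟨hg.aemeasurable, hf.1.aemeasurable, hgf⟩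
    exact ⟨hg, h.memLp_iff.2 hf.2⟩
  · have h : ProbabilityTheory.IdentDistrib g f P P := ⟨hg.aemeasurable, hf.1.aemeasurable, hgf⟩
    exact ⟨hg, fun p => h.memLp_iff.2 (hf.2 p)⟩

theorem label_comp_mem [IsFiniteMeasure P] (hF : F = LInfty P ∨ F = MInfty P) {N : ℕ}
    {κ : S → Fin N} (hκ : Measurable κ) (x : Fin N → ℝ) : (fun s => x (κ s)) ∈ F := by
  have hm : Measurable fun s => x (κ s) := (measurable_of_finite x).comp hκ
  have hb : MemLp (fun s => x (κ s)) ∞ P :=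
    memLp_top_of_bound hm.aestronglyMeasurable ‖x‖
      (Eventually.of_forall fun s => norm_le_pi_norm x _)
  rcases hF with rfl | rfl
  · exact ⟨hm, hb⟩
  · exact ⟨hm, fun p => hb.mono_exponent le_top⟩

/-- Here the equal probabilities matter. Exchanging two labels supplies the competitor `g` with the
law of the insurance contract. -/
theorem eqDistr_label_perm {N : ℕ} {κ : S → Fin N} (hκ : IsUniformLabel P κ) (x : Fin N → ℝ)
    (σ : Equiv.Perm (Fin N)) : EqDistr P (fun s => x (σ (κ s))) (fun s => x (κ s)) := by
  have h : P.map (fun s => σ (κ s)) = P.map κ := by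
    have hm : Measurable fun s => σ (κ s) := (measurable_of_finite σ).comp hκ.1
    refine Measure.ext_of_singleton fun i => ?_
    rw [Measure.map_apply hm (measurableSet_singleton i),
      Measure.map_apply hκ.1 (measurableSet_singleton i), hκ.2, ← hκ.2 (σ.symm i)]
    congr 1
    ext s
    simp [Equiv.eq_symm_apply]
  have hx := measurable_of_finite x
  calc P.map (fun s => x (σ (κ s))) = (P.map fun s => σ (κ s)).map x :=
        (Measure.map_map hx ((measurable_of_finite σ).comp hκ.1)).symm
    _ = P.map (fun s => x (κ s)) := by rw [h, Measure.map_map hx hκ.1]; rfl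

theorem StopLossGE.congr_eqDistr {f g f' g' : S → ℝ} (hf : Measurable f) (hg : Measurable g)
    (hf' : Measurable f') (hg' : Measurable g') (hff' : EqDistr P f' f) (hgg' : EqDistr P g' g)
    (h : StopLossGE P f g) : StopLossGE P f' g' := by
  have key : ∀ u v : S → ℝ, Measurable u → Measurable v → EqDistr P u v →
      ∫ s, u s ∂P = ∫ s, v s ∂P ∧ ∀ c : ℝ, ∫ s, max (c - u s) 0 ∂P = ∫ s, max (c - v s) 0 ∂P := by
    intro u v hu hv huv
    have hi : ProbabilityTheory.IdentDistrib u v P P := ⟨hu.aemeasurable, hv.aemeasurable, huv⟩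
    exact ⟨hi.integral_eq, fun c => (hi.comp (u := fun x => max (c - x) 0)
      (by fun_prop)).integral_eq⟩
  obtain ⟨h1, h2⟩ := key f' f hf' hf hff'
  obtain ⟨h3, h4⟩ := key g' g hg' hg hgg'
  exact ⟨by rw [h1, h3, h.1], fun c => by rw [h2, h4]; exact h.2 c⟩

/-- The cells of a uniform generating partition label the states, and the labels determine every
random variable. -/
theorem UniformOnGeneratingPartition.exists_label (h : UniformOnGeneratingPartition P) :
    ∃ (N : ℕ) (κ : S → Fin N), IsUniformLabel P κ ∧
      ∀ f : S → ℝ, Measurable f → ∃ x : Fin N → ℝ, f = fun s => x (κ s) := by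
  obtain ⟨N, C, hdisj, hcover, hgen, hP⟩ := h
  have hmem : ∀ s, ∃ i, s ∈ C i := fun s => Set.mem_iUnion.1 (hcover ▸ Set.mem_univ s)
  choose κ hκ using hmem
  have hpre : ∀ i, κ ⁻¹' {i} = C i := by
    intro i
    ext s
    refine ⟨fun hs => by rw [← (show κ s = i from hs)]; exact hκ s, fun hs => ?_⟩
    by_contra hne
    exact (hdisj hne).ne_of_mem (hκ s) hs rfl
  have hC : ∀ i, MeasurableSet (C i) := fun i => by
    rw [hgen]; exact MeasurableSpace.measurableSet_generateFrom ⟨i, rfl⟩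
  refine ⟨N, κ, ⟨measurable_to_countable' fun i => by rw [hpre]; exact hC i, fun i => by
    rw [hpre]; exact hP i⟩, fun f hf => ?_⟩
  have hle : ‹MeasurableSpace S› ≤ MeasurableSpace.comap κ ⊤ := by
    rw [hgen]
    refine MeasurableSpace.generateFrom_le ?_
    rintro _ ⟨i, rfl⟩
    exact ⟨{i}, trivial, hpre i⟩
  obtain ⟨x, -, hx⟩ := (hf.mono hle le_rfl).exists_eq_measurable_comp
  exact ⟨x, hx⟩

end PayoffSpace

/-! ### From transfers to the stop-loss order -/

section Transfers

variable {S : Type*} [MeasurableSpace S] {P : Measure S} {F : Submodule ℝ (S → ℝ)}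
  {R : F → F → Prop}

/-- Convergence in every sense in which a continuous preference may be required to respect
limits. -/
def StronglyConverges (P : Measure S) (u : ℕ → F) (f : F) : Prop :=
  MomentConverges P u f ∧ (F = LInfty P → BoundedAEConverges P u f)

theorem continuousFor_stronglyConverges
    (hcont : ContinuousFor (MomentConverges P) R ∨
      (F = LInfty P ∧ ContinuousFor (BoundedAEConverges P) R)) :
    ContinuousFor (StronglyConverges P) R := by
  intro u v f g hu hv h
  rcases hcont with hc | ⟨hF, hc⟩
  · exact hc u v f g hu.1 hv.1 h
  · exact hc u v f g (hu.2 hF) (hv.2 hF) h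

/-- Payoffs that depend on equally likely labels are preferred after a Robin Hood transfer, here
the passage from `z - d e_j + d e_k` to `z`. -/
def PropenseToTransfers (P : Measure S) (R : F → F → Prop) : Prop :=
  ∀ (N : ℕ) (κ : S → Fin N), IsUniformLabel P κ → ∀ (z : Fin N → ℝ) (j k : Fin N) (d : ℝ),
    j ≠ k → 0 ≤ d → z j ≤ z k → ∀ f g : F, (f : S → ℝ) = (fun s => z (κ s)) →
      (g : S → ℝ) = (fun s => (z - Pi.single j d + Pi.single k d : Fin N → ℝ) (κ s)) → R f g

theorem PropenseToTransfers.rel_labelAverage [IsProbabilityMeasure P]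
    (hF : F = LInfty P ∨ F = MInfty P) (hR : IsRiskPreference P R)
    (hT : PropenseToTransfers P R) {N : ℕ} {κ : S → Fin N} (hκ : IsUniformLabel P κ)
    {f g : S → ℝ} (hf : Integrable f P) (hg : Integrable g P) (h : StopLossGE P f g)
    (hfs : ∀ s s', κ s < κ s' → f s ≤ f s') (hgs : ∀ s s', κ s < κ s' → g s ≤ g s')
    (u v : F) (hu : (u : S → ℝ) = fun s => labelAverage P κ f (κ s))
    (hv : (v : S → ℝ) = fun s => labelAverage P κ g (κ s)) : R u v := by
  let e : (Fin N → ℝ) → F := fun x => ⟨fun s => x (κ s), label_comp_mem hF hκ.1 x⟩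
  have hQ : R (e (labelAverage P κ f)) (e (labelAverage P κ g)) := by
    refine rel_of_partialSums_le (fun x y => R (e x) (e y))
      (fun x => (hR.law_invariant _ _ rfl).1) (fun x y z => hR.trans _ _ _)
      (fun y j k d hjk hd hle =>
        hT N κ hκ (y + Pi.single j d - Pi.single k d) j k d hjk hd ?_ _ _ rfl ?_)
      (monotone_labelAverage hκ hf hfs) _ (h.sum_labelAverage_le hκ.1 hf hg hgs) ?_
    · simpa [hjk, hjk.symm] using hle
    · ext s; simp only [Pi.add_apply, Pi.sub_apply, e]; ring
    · rw [sum_labelAverage hκ.1 hf, sum_labelAverage hκ.1 hg]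
      simp [h.1]
  rwa [show u = e (labelAverage P κ f) from Subtype.ext hu,
    show v = e (labelAverage P κ g) from Subtype.ext hv]

/-- Conditional expectation contracts the moments and preserves essential bounds. Hence the moments
of order `p + 1` of the errors stay bounded, which upgrades convergence in mean to every order, and
in `LInfty P` the almost sure convergence is bounded. -/
theorem stronglyConverges_labelAverage [IsProbabilityMeasure P]
    (hF : F = LInfty P ∨ F = MInfty P) {N : ℕ → ℕ} {κ : ∀ n, S → Fin (N n)}
    (hκ : ∀ n, IsUniformLabel P (κ n)) (f : F)
    (hae : ∀ᵐ s ∂P, Tendsto (fun n => labelAverage P (κ n) f (κ n s)) atTop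
      (𝓝 ((f : S → ℝ) s)))
    (hlim : Tendsto (fun n => ∫ s, |labelAverage P (κ n) f (κ n s) - (f : S → ℝ) s| ∂P) atTop
      (𝓝 0)) :
    StronglyConverges P
      (fun n => ⟨fun s => labelAverage P (κ n) f (κ n s), label_comp_mem hF (hκ n).1 _⟩) f := by
  have hfi : Integrable (f : S → ℝ) P := integrable_of_mem hF f.2
  let a : ℕ → S → ℝ := fun n s => labelAverage P (κ n) f (κ n s)
  have hcond : ∀ n, P[(f : S → ℝ) | MeasurableSpace.comap (κ n) ⊤] = a n :=
    fun n => condExp_comap_label (hκ n) hfi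
  have ha : ∀ n, a n ∈ F := fun n => label_comp_mem hF (hκ n).1 _
  have hpow : ∀ u : S → ℝ, u ∈ F → ∀ r : ℕ, 1 ≤ r → Integrable (fun s => |u s| ^ r) P := by
    intro u hu r hr
    simpa using ((memLp_of_mem hF hu).2 r).integrable_norm_pow (by omega)
  have hdiff : ∀ n, (fun s => a n s - (f : S → ℝ) s) ∈ F := fun n => F.sub_mem (ha n) f.2
  constructor
  · intro p hp
    refine tendsto_integral_abs_pow_of_tendsto_integral_abs
      (h := fun n s => a n s - (f : S → ℝ) s) hp
      (M := 2 ^ p * (∫ s, |(f : S → ℝ) s| ^ (p + 1) ∂P + ∫ s, |(f : S → ℝ) s| ^ (p + 1) ∂P))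
      (fun n => by simpa using hpow _ (hdiff n) 1 le_rfl)
      (fun n => hpow _ (hdiff n) _ (by omega)) (fun n => ?_) hlim
    have hfp := hpow _ f.2 (p + 1) (by omega)
    have hap := hpow _ (ha n) (p + 1) (by omega)
    have hcontr : ∫ s, |a n s| ^ (p + 1) ∂P ≤ ∫ s, |(f : S → ℝ) s| ^ (p + 1) ∂P := by
      have hr : (1 : ℝ) ≤ ((p + 1 : ℕ) : ℝ) := by exact_mod_cast Nat.succ_le_succ (Nat.zero_le p)
      have := integral_norm_condExp_rpow_le (m := MeasurableSpace.comap (κ n) ⊤) (μ := P) hr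
        (f := (f : S → ℝ)) (by
          simpa only [Pi.pow_def, Real.rpow_natCast, Real.norm_eq_abs] using hfp)
      simpa only [hcond, Real.rpow_natCast, Real.norm_eq_abs] using this
    calc ∫ s, |a n s - (f : S → ℝ) s| ^ (p + 1) ∂P
        ≤ ∫ s, 2 ^ p * (|a n s| ^ (p + 1) + |(f : S → ℝ) s| ^ (p + 1)) ∂P := by
          refine integral_mono (hpow _ (hdiff n) _ (by omega)) ((hap.add hfp).const_mul _) ?_
          intro s
          exact (pow_le_pow_left₀ (abs_nonneg _) (abs_sub _ _) _).trans
            (add_pow_le (abs_nonneg _) (abs_nonneg _) (p + 1))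
      _ = 2 ^ p * (∫ s, |a n s| ^ (p + 1) ∂P + ∫ s, |(f : S → ℝ) s| ^ (p + 1) ∂P) := by
          rw [integral_const_mul, integral_add hap hfp]
      _ ≤ _ := by gcongr
  · intro hFL
    have hfL : (f : S → ℝ) ∈ LInfty P := hFL ▸ f.2
    have hb : ∀ᵐ s ∂P, |(f : S → ℝ) s| ≤
        (eLpNorm (f : S → ℝ) ∞ P).toNNReal := by
      filter_upwards [ae_le_eLpNormEssSup (f := (f : S → ℝ)) (μ := P)] with s hs
      rw [← eLpNorm_exponent_top, ← ENNReal.coe_toNNReal hfL.2.2.ne] at hs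
      simpa [enorm_eq_nnnorm, ← NNReal.coe_le_coe] using hs
    refine ⟨⟨(eLpNorm (f : S → ℝ) ∞ P).toNNReal, fun n => ?_⟩, hae⟩
    have := ae_bdd_abs_condExp_of_ae_bdd_abs (m := MeasurableSpace.comap (κ n) ⊤) hb
    simpa only [hcond] using this

theorem PropenseToTransfers.rel_of_stopLossGE [IsProbabilityMeasure P] (hP : Adequate P)
    (hF : F = LInfty P ∨ F = MInfty P) (hR : IsRiskPreference P R)
    (hcont : ContinuousFor (StronglyConverges P) R) (hT : PropenseToTransfers P R)
    (f g : F) (h : StopLossGE P (f : S → ℝ) (g : S → ℝ)) : R f g := by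
  have hm : ∀ u : F, Measurable (u : S → ℝ) := fun u => (memLp_of_mem hF u.2).1
  have hi : ∀ u : F, Integrable (u : S → ℝ) P := fun u => integrable_of_mem hF u.2
  have hreduce : ∀ f' g' : F, EqDistr P (f' : S → ℝ) f → EqDistr P (g' : S → ℝ) g →
      R f' g' → R f g := fun f' g' hf hg hfg =>
    hR.trans _ _ _ (hR.law_invariant f f' hf.symm).1
      (hR.trans _ _ _ hfg (hR.law_invariant g' g hg).1)
  rcases hP with hP | hP
  · obtain ⟨κ, hκ, happ⟩ := hP.exists_sorted_approximation
    obtain ⟨f', hf'm, hf'd, hf's, hf'ae, hf'l⟩ := happ f (hm f) (hi f)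
    obtain ⟨g', hg'm, hg'd, hg's, hg'ae, hg'l⟩ := happ g (hm g) (hi g)
    let u : F := ⟨f', mem_of_eqDistr hF f.2 hf'm hf'd⟩
    let v : F := ⟨g', mem_of_eqDistr hF g.2 hg'm hg'd⟩
    refine hreduce u v hf'd hg'd (hcont _ _ u v
      (stronglyConverges_labelAverage hF hκ u hf'ae hf'l)
      (stronglyConverges_labelAverage hF hκ v hg'ae hg'l) fun n => ?_)
    exact hT.rel_labelAverage hF hR (hκ n) (hi u) (hi v)
      (h.congr_eqDistr (hm f) (hm g) hf'm hg'm hf'd hg'd) (hf's n) (hg's n) _ _ rfl rfl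
  -- Every payoff is a function of the label here: sorting is a permutation of labels and averaging
  -- changes nothing, so no limit is needed.
  · obtain ⟨N, κ, hκ, hall⟩ := hP.exists_label
    obtain ⟨x, hx⟩ := hall f (hm f)
    obtain ⟨y, hy⟩ := hall g (hm g)
    let e : (Fin N → ℝ) → F := fun x => ⟨fun s => x (κ s), label_comp_mem hF hκ.1 x⟩
    have hfd : EqDistr P (e (x ∘ Tuple.sort x) : S → ℝ) f := by
      rw [hx]; exact eqDistr_label_perm hκ x _
    have hgd : EqDistr P (e (y ∘ Tuple.sort y) : S → ℝ) g := by
      rw [hy]; exact eqDistr_label_perm hκ y _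
    refine hreduce _ _ hfd hgd (hT.rel_labelAverage hF hR hκ (hi _) (hi _)
      (h.congr_eqDistr (hm f) (hm g) (hm _) (hm _) hfd hgd)
      (fun s s' hs => Tuple.monotone_sort x hs.le) (fun s s' hs => Tuple.monotone_sort y hs.le)
      _ _ ?_ ?_)
    · exact funext fun s => (congrFun (labelAverage_comp hκ (x ∘ Tuple.sort x)) (κ s)).symm
    · exact funext fun s => (congrFun (labelAverage_comp hκ (y ∘ Tuple.sort y)) (κ s)).symm

end Transfers

/-! ### Transfers from risk aversion and from insurance -/

section Necessity

variable {S : Type*} [MeasurableSpace S] {P : Measure S} {F : Submodule ℝ (S → ℝ)}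
  {R : F → F → Prop}

theorem extExpectation_eq_integral {X : S → ℝ} (hX : Integrable X P) :
    extExpectation P X = ((∫ s, X s ∂P : ℝ) : EReal) := by
  rw [extExpectation, integral_eq_lintegral_pos_part_sub_lintegral_neg_part hX, EReal.coe_sub,
    EReal.coe_ennreal_toReal, EReal.coe_ennreal_toReal]
  · exact (hX.neg.lintegral_lt_top).ne
  · exact hX.lintegral_lt_top.ne

/-- The concave test functions are `x`, `-x` and `-max (c - x) 0`; their expectations are finite. -/
theorem stopLossGE_of_concaveGE [IsFiniteMeasure P] {f g : S → ℝ} (hf : Integrable f P)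
    (hg : Integrable g P) (h : ConcaveGE P f g) : StopLossGE P f g := by
  have key : ∀ φ : ℝ → ℝ, ConcaveOn ℝ Set.univ φ → Integrable (fun s => φ (f s)) P →
      Integrable (fun s => φ (g s)) P → ∫ s, φ (g s) ∂P ≤ ∫ s, φ (f s) ∂P := by
    intro φ hφ h1 h2
    have := h φ hφ
    rw [extExpectation_eq_integral h1, extExpectation_eq_integral h2] at this
    exact_mod_cast this
  refine ⟨le_antisymm ?_ (key _ (concaveOn_id convex_univ) hf hg), fun c => ?_⟩
  · have := key _ (convexOn_id convex_univ).neg hf.neg hg.neg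
    simpa [integral_neg] using this
  · have hconv : ConvexOn ℝ Set.univ fun x : ℝ => max (c - x) 0 :=
      (((convexOn_const c convex_univ).sub (concaveOn_id convex_univ)).sup
        (convexOn_const 0 convex_univ))
    have := key _ hconv.neg (integrable_shortfall hf c).neg (integrable_shortfall hg c).neg
    simpa [integral_neg] using this

/-- Both `x` and `y` are convex combinations of `x - d` and `y + d`, with weights interchanged. -/
theorem _root_.ConcaveOn.map_sub_add_map_add_le {φ : ℝ → ℝ} (hφ : ConcaveOn ℝ Set.univ φ)
    {x y d : ℝ} (hxy : x ≤ y) (hd : 0 ≤ d) : φ (x - d) + φ (y + d) ≤ φ x + φ y := by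
  rcases hd.eq_or_lt with rfl | hd
  · simp
  obtain ⟨L, rfl⟩ : ∃ L, y = x + L - 2 * d := ⟨y - x + 2 * d, by ring⟩
  have hL : 0 < L := by linarith
  have ha : 0 ≤ d / L := by positivity
  have hb : 0 ≤ 1 - d / L := by rw [sub_nonneg, div_le_one hL]; linarith
  have h1 := hφ.2 (Set.mem_univ (x - d)) (Set.mem_univ (x + L - 2 * d + d)) hb ha (by ring)
  have h2 := hφ.2 (Set.mem_univ (x - d)) (Set.mem_univ (x + L - 2 * d + d)) ha hb (by ring)
  have e1 : (1 - d / L) * (x - d) + d / L * (x + L - 2 * d + d) = x := by field_simp; ring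
  have e2 : d / L * (x - d) + (1 - d / L) * (x + L - 2 * d + d) = x + L - 2 * d := by
    field_simp; ring
  simp only [smul_eq_mul, e1, e2] at h1 h2
  linarith

theorem StronglyRiskAverse.propenseToTransfers [IsProbabilityMeasure P]
    (h : StronglyRiskAverse P R) : PropenseToTransfers P R := by
  intro N κ hκ z j k d hjk hd hz f g hf hg
  refine h f g fun φ hφ => ?_
  have hi : ∀ x : Fin N → ℝ, Integrable (fun s => x (κ s)) P := fun x =>
    integrable_of_mem (Or.inl rfl) (label_comp_mem (Or.inl rfl) hκ.1 x)
  have hint : ∀ x : Fin N → ℝ, ∑ i, x i = N * ∫ s, x (κ s) ∂P := by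
    intro x
    have := sum_labelAverage hκ.1 (hi x) Finset.univ
    rw [labelAverage_comp hκ] at this
    simpa using this
  set y : Fin N → ℝ := z - Pi.single j d + Pi.single k d with hy
  have hyj : y j = z j - d := by simp [hy, hjk]
  have hyk : y k = z k + d := by simp [hy, hjk.symm]
  simp only [hf, hg]
  rw [extExpectation_eq_integral (hi fun i => φ (z i)),
    extExpectation_eq_integral (hi fun i => φ (y i)), EReal.coe_le_coe_iff]
  have hN : (0 : ℝ) < N := by have := j.pos; positivity
  refine le_of_mul_le_mul_left ?_ hN
  rw [← hint fun i => φ (y i), ← hint fun i => φ (z i)]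
  have htwo : φ (y j) + φ (y k) ≤ φ (z j) + φ (z k) := by
    rw [hyj, hyk]
    exact hφ.map_sub_add_map_add_le hz hd
  have hrest : ∀ i ∉ ({j, k} : Finset (Fin N)), φ (y i) = φ (z i) := by
    intro i hi'
    simp only [Finset.mem_insert, Finset.mem_singleton, not_or] at hi'
    simp [hy, hi'.1, hi'.2]
  rw [← Finset.sum_add_sum_compl {j, k} fun i => φ (y i),
    ← Finset.sum_add_sum_compl {j, k} fun i => φ (z i),
    Finset.sum_congr rfl fun i hi' => hrest i (Finset.mem_compl.1 hi'),
    Finset.sum_pair hjk, Finset.sum_pair hjk]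
  linarith

theorem PropenseToDeductibleLimitInsurance.propenseToTransfers [IsProbabilityMeasure P]
    (hF : F = LInfty P ∨ F = MInfty P) (h : PropenseToDeductibleLimitInsurance P R) :
    PropenseToTransfers P R := by
  classical
  intro N κ hκ z j k d hjk hd hz f g hf hg
  let e : (Fin N → ℝ) → F := fun x => ⟨fun s => x (κ s), label_comp_mem hF hκ.1 x⟩
  -- The contract pays `d` at `j` and wherever `z` is below `z k`, and `0` elsewhere, in particular
  -- at `k`. With `w = z - a` this is deductible `-z k` and limit `d`; exchanging `j` and `k` in it
  -- undoes the transfer. Naming `j` separately covers `z j = z k`.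
  let a : Fin N → ℝ := fun i => if i = j ∨ z i < z k then d else 0
  have hak : a k = 0 := by simp [a, hjk.symm]
  have haj : a j = d := by simp [a]
  have hR := h (e (z - a)) (e a) (e (a ∘ Equiv.swap j k)) (eqDistr_label_perm hκ a _) ?_
  · convert hR using 1
    · ext s; simp [hf, e]
    · ext s
      simp only [hg, e, Submodule.coe_add, Pi.add_apply, Pi.sub_apply, Function.comp_apply]
      generalize κ s = i
      by_cases hij : i = j
      · subst hij; simp [hak, haj, hjk]
      by_cases hik : i = k
      · subst hik; simp [hak, haj, hjk.symm]
      · simp [Equiv.swap_apply_of_ne_of_ne hij hik, hij, hik]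
  · refine ⟨0, -z k, d, hd, fun s => ?_⟩
    simp only [e, Pi.sub_apply, sub_zero]
    generalize κ s = i
    by_cases hi : i = j ∨ z i < z k
    · have hle : z i ≤ z k := by
        rcases hi with rfl | hi
        · exact hz
        · exact hi.le
      simp only [a, if_pos hi]
      rw [min_eq_right]
      exact le_max_of_le_left (by linarith)
    · simp only [a, if_neg hi]
      rw [max_eq_right (by have := not_lt.1 (not_or.1 hi).2; linarith), min_eq_left hd]

theorem stronglyConverges_label [IsProbabilityMeasure P] {N : ℕ} {κ : S → Fin N}
    {x : ℕ → Fin N → ℝ} {y : Fin N → ℝ} (hx : Tendsto x atTop (𝓝 y)) (u : ℕ → F) (v : F)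
    (hu : ∀ n s, (u n : S → ℝ) s = x n (κ s)) (hv : ∀ s, (v : S → ℝ) s = y (κ s)) :
    StronglyConverges P u v := by
  refine ⟨fun p hp => ?_, fun _ => ⟨?_, Eventually.of_forall fun s => ?_⟩⟩
  · have h0 : Tendsto (fun n => dist (x n) y ^ p) atTop (𝓝 0) := by
      simpa [show p ≠ 0 by omega] using ((tendsto_iff_dist_tendsto_zero.1 hx).pow p)
    refine squeeze_zero (fun n => integral_nonneg fun s => by positivity) (fun n => ?_) h0
    refine (integral_mono_of_nonneg (Eventually.of_forall fun s => by positivity)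
      (integrable_const (dist (x n) y ^ p)) (Eventually.of_forall fun s => ?_)).trans (by simp)
    simp only [hu, hv, ← Real.dist_eq]
    gcongr
    exact dist_le_pi_dist _ _ _
  · obtain ⟨C, hC⟩ := (Metric.isBounded_range_of_tendsto x hx).exists_norm_le
    refine ⟨C, fun n => Eventually.of_forall fun s => ?_⟩
    rw [hu, ← Real.norm_eq_abs]
    exact (norm_le_pi_norm _ _).trans (hC _ ⟨n, rfl⟩)
  · simp only [hu, hv]
    exact tendsto_pi_nhds.1 hx _

theorem PropenseToProportionalInsurance.propenseToTransfers [IsProbabilityMeasure P]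
    (hF : F = LInfty P ∨ F = MInfty P) (hR : IsRiskPreference P R)
    (hcont : ContinuousFor (StronglyConverges P) R) (h : PropenseToProportionalInsurance P R) :
    PropenseToTransfers P R := by
  intro N κ hκ
  let e : (Fin N → ℝ) → F := fun x => ⟨fun s => x (κ s), label_comp_mem hF hκ.1 x⟩
  have hlt : ∀ (z : Fin N → ℝ) (j k : Fin N) (d : ℝ), j ≠ k → 0 ≤ d → z j < z k →
      R (e z) (e (z - Pi.single j d + Pi.single k d)) := by
    intro z j k d hjk hd hz
    rcases hd.eq_or_lt with rfl | hd
    · simpa using (hR.law_invariant (e z) (e z) rfl).1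
    -- Take `w = (1 + t) z` and `f = -t z`, so that `w + f = z`. Exchanging `j` and `k` in `f`
    -- changes its values there by `t * (z k - z j) = d`, downwards at `j` and upwards at `k`.
    set t := d / (z k - z j) with ht
    have ht0 : 0 < t := div_pos hd (by linarith)
    have htd : t * (z k - z j) = d := div_mul_cancel₀ _ (by linarith)
    have hrel := h (e fun i => (1 + t) * z i) (e fun i => -t * z i)
      (e fun i => -t * z (Equiv.swap j k i))
      (eqDistr_label_perm hκ (fun i => -t * z i) (Equiv.swap j k))
      ⟨0, 1 / (1 + t), by positivity, ?_, fun s => ?_⟩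
    · convert hrel using 1
      · ext s; simp only [e, Submodule.coe_add, Pi.add_apply]; ring
      · ext s
        simp only [e, Submodule.coe_add, Pi.add_apply, Pi.sub_apply]
        generalize κ s = i
        by_cases hij : i = j
        · subst hij; simp [hjk]; linarith
        by_cases hik : i = k
        · subst hik; simp [hjk.symm]; linarith
        · simp [Equiv.swap_apply_of_ne_of_ne hij hik, hij, hik]; ring
    · rw [div_lt_one (by linarith)]; linarith
    · simp only [e]; field_simp; ring
  intro z j k d hjk hd hz f g hf hg
  have hfe : f = e z := Subtype.ext hf
  have hge : g = e (z - Pi.single j d + Pi.single k d) := Subtype.ext hg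
  rw [hfe, hge]
  -- No `t` exists when `z j = z k`; raising `z k` slightly makes the inequality strict, and
  -- continuity removes the perturbation.
  let r : ℕ → ℝ := fun n => 1 / ((n : ℝ) + 1)
  have hr : Tendsto r atTop (𝓝 0) := tendsto_one_div_add_atTop_nhds_zero_nat
  have hcoord : ∀ i : Fin N, Tendsto (fun n => (Pi.single i (r n) : Fin N → ℝ)) atTop (𝓝 0) := by
    intro i
    have hc : Continuous fun a : ℝ => (Pi.single i a : Fin N → ℝ) :=
      continuous_single (A := fun _ : Fin N => ℝ) i
    simpa [Function.comp_def] using (hc.tendsto 0).comp hr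
  let x : ℕ → Fin N → ℝ := fun n => z + Pi.single k (r n)
  have hx : Tendsto x atTop (𝓝 z) := by simpa using (hcoord k).const_add z
  refine hcont (fun n => e (x n)) (fun n => e (x n - Pi.single j d + Pi.single k d)) _ _
    (stronglyConverges_label hx _ _ (fun _ _ => rfl) fun _ => rfl)
    (stronglyConverges_label ((hx.sub_const _).add_const _) _ _ (fun _ _ => rfl) fun _ => rfl)
    fun n => hlt (x n) j k d hjk hd ?_
  have : 0 < r n := by positivity
  simp only [x, Pi.add_apply, Pi.single_eq_same, Pi.single_eq_of_ne hjk, add_zero]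
  linarith

end Necessity

/-! ### Better hedges and contingency schedules -/

section Hedging

variable {S : Type*} [MeasurableSpace S] {P : Measure S} {F : Submodule ℝ (S → ℝ)}
  {R : F → F → Prop}

/-- The shortfall of `w + f` below `c` is the length of the interval from `w` to `c - f`; Tonelli
does the rest. Only joint lower-tail probabilities remain, and these are what a better hedge
reduces. -/
theorem lintegral_shortfall_add [SFinite P] {w f : S → ℝ} (hw : Measurable w) (hf : Measurable f)
    (c : ℝ) : ∫⁻ s, ENNReal.ofReal (c - (w s + f s)) ∂P =
      ∫⁻ u, P ({s | w s ≤ u} ∩ {s | f s ≤ c - u}) := by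
  have hE : MeasurableSet ({z : S × ℝ | w z.1 ≤ z.2} ∩ {z | f z.1 ≤ c - z.2}) :=
    (measurableSet_le (hw.comp measurable_fst) measurable_snd).inter
      (measurableSet_le (hf.comp measurable_fst) (measurable_const.sub measurable_snd))
  have h1 := Measure.prod_apply (μ := P) (ν := (volume : Measure ℝ)) hE
  rw [Measure.prod_apply_symm hE] at h1
  refine Eq.trans (lintegral_congr fun s => ?_) h1.symm
  have : Prod.mk s ⁻¹' ({z : S × ℝ | w z.1 ≤ z.2} ∩ {z | f z.1 ≤ c - z.2}) =
      Set.Icc (w s) (c - f s) := by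
    ext u
    simp only [Set.preimage_inter, Set.mem_inter_iff, Set.mem_preimage, Set.mem_ofPred_eq,
      Set.mem_Icc]
    exact and_congr_right fun _ => by constructor <;> intro h <;> linarith
  rw [this, Real.volume_Icc]
  congr 1
  ring

theorem IsBetterHedge.measure_inter_le [IsFiniteMeasure P] {w f g : S → ℝ} (hw : Measurable w)
    (h : IsBetterHedge P w f g) (τ l : ℝ) :
    P ({s | w s ≤ l} ∩ {s | f s ≤ τ}) ≤ P ({s | w s ≤ l} ∩ {s | g s ≤ τ}) := by
  have hA : MeasurableSet {s | w s ≤ l} := measurableSet_le hw measurable_const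
  by_cases h0 : P {s | w s ≤ l} = 0
  · rw [measure_mono_null Set.inter_subset_left h0]; exact zero_le
  have := h.2 τ l
  rw [ProbabilityTheory.cond_apply hA, ProbabilityTheory.cond_apply hA] at this
  exact (ENNReal.mul_le_mul_iff_right (ENNReal.inv_ne_zero.2 (measure_ne_top _ _))
    (ENNReal.inv_ne_top.2 h0)).1 this

theorem IsBetterHedge.stopLossGE_add [IsFiniteMeasure P] {w f g : S → ℝ} (hw : Measurable w)
    (hf : Measurable f) (hg : Measurable g) (hwi : Integrable w P) (hfi : Integrable f P)
    (hgi : Integrable g P) (h : IsBetterHedge P w f g) : StopLossGE P (w + f) (w + g) := by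
  have hfg : ProbabilityTheory.IdentDistrib f g P P := ⟨hf.aemeasurable, hg.aemeasurable, h.1⟩
  refine ⟨?_, fun c => ?_⟩
  · simp only [Pi.add_apply]
    rw [integral_add hwi hfi, integral_add hwi hgi, hfg.integral_eq]
  · have key : ∀ u : S → ℝ, Integrable u P →
        ∫ s, max (c - (w + u) s) 0 ∂P = (∫⁻ s, ENNReal.ofReal (c - (w s + u s)) ∂P).toReal := by
      intro u hui
      rw [integral_eq_lintegral_of_nonneg_ae (f := fun s => max (c - (w + u) s) 0)
        (Eventually.of_forall fun s => le_max_right _ _)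
        (integrable_shortfall (hwi.add hui) c).aestronglyMeasurable]
      congr 1
      refine lintegral_congr fun s => ?_
      rw [ENNReal.ofReal_max]
      simp
    rw [key f hfi, key g hgi]
    refine ENNReal.toReal_mono ?_ ?_
    · exact ((integrable_const c).sub (hwi.add hgi)).lintegral_lt_top.ne
    · rw [lintegral_shortfall_add hw hf, lintegral_shortfall_add hw hg]
      exact lintegral_mono fun u => h.measure_inter_le hw _ _

/-- Opposite ordering of `w` and `f` makes their joint lower tails minimal for the given laws:
either zero or the Fréchet bound `P A + P B - 1`. -/
theorem IsContingencyScheduleInsurance.isBetterHedge [IsProbabilityMeasure P] {w f g : S → ℝ}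
    (hw : Measurable w) (hf : Measurable f) (hg : Measurable g) (hgf : EqDistr P g f)
    (h : IsContingencyScheduleInsurance P w f) : IsBetterHedge P w f g := by
  refine ⟨hgf.symm, fun τ l => ?_⟩
  have hA : MeasurableSet {s | w s ≤ l} := measurableSet_le hw measurable_const
  have hB : MeasurableSet {s | f s ≤ τ} := measurableSet_le hf measurable_const
  have hC : MeasurableSet {s | g s ≤ τ} := measurableSet_le hg measurable_const
  have hBC : P.real {s | g s ≤ τ} = P.real {s | f s ≤ τ} := by
    have hi : ProbabilityTheory.IdentDistrib g f P P := ⟨hg.aemeasurable, hf.aemeasurable, hgf⟩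
    exact congrArg ENNReal.toReal (hi.measure_mem_eq measurableSet_Iic)
  rw [ProbabilityTheory.cond_apply hA, ProbabilityTheory.cond_apply hA]
  refine mul_le_mul_right ?_ _
  -- A state in both tails paired with a state in neither violates the schedule, so the product of
  -- these two events is null.
  have hnull : P ({s | w s ≤ l} ∩ {s | f s ≤ τ}) * P ({s | w s ≤ l} ∪ {s | f s ≤ τ})ᶜ = 0 := by
    rw [← Measure.prod_prod]
    refine measure_mono_null ?_ (ae_iff.1 h)
    rintro ⟨s, s'⟩ ⟨⟨h1, h2⟩, h3⟩
    simp only [Set.mem_compl_iff, Set.mem_union, Set.mem_ofPred_eq, not_or, not_le] at h1 h2 h3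
    simp only [Set.mem_ofPred_eq, not_forall, not_le, ge_iff_le]
    exact ⟨by linarith, by linarith⟩
  rcases mul_eq_zero.1 hnull with h0 | h0
  · rw [h0]; exact zero_le
  · have h1 : P.real ({s | w s ≤ l} ∪ {s | f s ≤ τ}) = 1 := by
      rw [measureReal_def, (prob_compl_eq_zero_iff (hA.union hB)).1 h0]; simp
    have h2 := measureReal_union_add_inter (μ := P) (s := {s | w s ≤ l}) hB
    have h3 := measureReal_union_add_inter (μ := P) (s := {s | w s ≤ l}) hC
    have h4 : P.real ({s | w s ≤ l} ∪ {s | g s ≤ τ}) ≤ 1 := measureReal_le_one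
    refine (ENNReal.toReal_le_toReal (measure_ne_top _ _) (measure_ne_top _ _)).1 ?_
    simp only [← measureReal_def]
    linarith

theorem IsIndemnityScheduleInsurance.isContingencyScheduleInsurance {w f : S → ℝ}
    (h : IsIndemnityScheduleInsurance w f) : IsContingencyScheduleInsurance P w f := by
  obtain ⟨I, hI, hf⟩ := h
  refine Eventually.of_forall fun z hz => ?_
  rw [hf, hf]
  exact hI ⟨z.2, rfl⟩ ⟨z.1, rfl⟩ hz.le

end Hedging

/-! ### Inclusions between classes of contracts -/

section Schedules

variable {S : Type*}

theorem IsDeductibleLimitInsurance.isIndemnityScheduleInsurance {w f : S → ℝ}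
    (h : IsDeductibleLimitInsurance w f) : IsIndemnityScheduleInsurance w f := by
  obtain ⟨π, δ, l, -, hf⟩ := h
  refine ⟨fun x => min (max (x - δ) 0) l - π, Monotone.monotoneOn (fun x y hxy => ?_) _, hf⟩
  gcongr

theorem IsProportionalInsurance.isIndemnityScheduleInsurance {w f : S → ℝ}
    (h : IsProportionalInsurance w f) : IsIndemnityScheduleInsurance w f := by
  obtain ⟨π, ε, -, hε, hf⟩ := h
  refine ⟨fun x => (1 - ε) * x - π, Monotone.monotoneOn (fun x y hxy => ?_) _, fun s => ?_⟩
  · have : 0 ≤ 1 - ε := by linarith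
    gcongr
  · rw [hf]; ring

end Schedules

end RiskInsurance

open RiskInsurance
theorem mainTheorem2 {S : Type*} [MeasurableSpace S] (P : Measure S) [IsProbabilityMeasure P]
    (hP : Adequate P) (F : Submodule ℝ (S → ℝ)) (hF : F = LInfty P ∨ F = MInfty P)
    (R : F → F → Prop) (hR : IsRiskPreference P R)
    (hcont : ContinuousFor (MomentConverges P) R ∨
      (F = LInfty P ∧ ContinuousFor (BoundedAEConverges P) R)) :
    List.TFAE
      [StronglyRiskAverse P R,
        PropenseToProportionalInsurance P R,
        PropenseToDeductibleLimitInsurance P R,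
        PropenseToIndemnityScheduleInsurance P R,
        PropenseToContingencyScheduleInsurance P R,
        PropenseToHedging P R] := by
  have hcont' := continuousFor_stronglyConverges hcont
  have hm : ∀ u : F, Measurable (u : S → ℝ) := fun u => (memLp_of_mem hF u.2).1
  have hi : ∀ u : F, Integrable (u : S → ℝ) P := fun u => integrable_of_mem hF u.2
  have hdom : PropenseToTransfers P R → ∀ f g : F, StopLossGE P (f : S → ℝ) (g : S → ℝ) → R f g :=
    fun hT => hT.rel_of_stopLossGE hP hF hR hcont'
  have hrisk : PropenseToTransfers P R → StronglyRiskAverse P R := fun hT f g hfg =>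
    hdom hT f g (stopLossGE_of_concaveGE (hi f) (hi g) hfg)
  -- Passing through transfers avoids extending stop-loss dominance to all concave functions, whose
  -- expectations may be infinite.
  tfae_have 1 → 6 := fun h w f g _ hfg => hdom h.propenseToTransfers _ _
    (hfg.stopLossGE_add (hm w) (hm f) (hm g) (hi w) (hi f) (hi g))
  tfae_have 6 → 5 := fun h w f g hgf hf =>
    h w f g hgf (hf.isBetterHedge (hm w) (hm f) (hm g) hgf)
  tfae_have 5 → 4 := fun h w f g hgf hf => h w f g hgf hf.isContingencyScheduleInsurance
  tfae_have 4 → 3 := fun h w f g hgf hf => h w f g hgf hf.isIndemnityScheduleInsurance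
  tfae_have 4 → 2 := fun h w f g hgf hf => h w f g hgf hf.isIndemnityScheduleInsurance
  tfae_have 2 → 1 := fun h => hrisk (h.propenseToTransfers hF hR hcont')
  tfae_have 3 → 1 := fun h => hrisk (h.propenseToTransfers hF)
  tfae_finish
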